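/- Let $\mathbf k$ be a field and let $H$ be a finite-dimensional quasi-Hopf algebra over $\mathbf k$, with coproduct $\Delta$, counit $\epsilon$, invertible reassociator $\phi=\sum X\otimes Y\otimes Z$, $\phi^{-1}=\sum\bar X\otimes\bar Y\otimes\bar Z$, invertible antipode $S$ and elements $\alpha,\beta\in H$; thus $\Delta,\epsilon$ are unital algebra morphisms, $S$ is an algebra anti-automorphism, and $$(\mathrm{id}\otimes\Delta)(\Delta(a))\,\phi=\phi\,(\Delta\otimes\mathrm{id})(\Delta(a)),\qquad (\mathrm{id}\otimes\mathrm{id}\otimes\Delta)(\phi)(\Delta\otimes\mathrm{id}\otimes\mathrm{id})(\phi)=(1\otimes\phi)(\mathrm{id}\otimes\Delta\otimes\mathrm{id})(\phi)(\phi\otimes1),$$ $$(\epsilon\otimes\mathrm{id})\Delta=\mathrm{id}=(\mathrm{id}\otimes\epsilon)\Delta,\quad(\mathrm{id}\otimes\epsilon\otimes\mathrm{id})(\phi)=1\otimes1,\quad S(a_{(1)})\alpha a_{(2)}=\epsilon(a)\alpha,\quad a_{(1)}\beta S(a_{(2)})=\epsilon(a)\beta,$$ $$\sum X\beta S(Y)\alpha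 Z=1=\sum S(\bar X)\alpha\bar Y\beta S(\bar Z).$$ Write $\psi^{21}$ for the flip of $\psi\in H\otimes H$, $\Delta^{op}(a)=\Delta(a)^{21}$, and put $\sum T\otimes U'\otimes V'\otimes W=(1\otimes\phi^{-1})(\mathrm{id}\otimes\mathrm{id}\otimes\Delta)(\phi)$ and $$\gamma=\sum S(U')\alpha V'\otimes S(T)\alpha W,\qquad f=\sum(S\otimes S)(\Delta^{op}(\bar X))\,\gamma\,\Delta(\bar Y\beta S(\bar Z)),\qquad h=(S^{-1}\otimes S^{-1})(f^{21}),$$ $$q_R=\sum X\otimes S^{-1}(\alpha Z)Y,\quad p_R=\sum\bar X\otimes\bar Y\beta S(\bar Z),\quad U=f^{-1}(S\otimes S)(q_R^{21}),\quad V=(S^{-1}\otimes S^{-1})(p_R^{21})\,h,\quad\bar\Delta(a)=V\Delta(a)U$$ ($f$ is invertible). Let $\hat H=\mathrm{Hom}_{\mathbf k}(H,\mathbf k)$ carry the $H$-bimodule structure $\langle a\cdot\psi\cdot b\mid m\rangle=\langle\psi\mid S^{-1}(a)\,m\,S(b)\rangle$ and the coaction $\rho:\hat H\to\hat H\otimes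 H\cong\mathrm{Hom}_{\mathbf k}(H,H)$, $\rho(\psi)(m)=(\mathrm{id}\otimes\psi)(\bar\Delta(m))$, $\rho(\psi)=\psi_{(0)}\otimes\psi_{(1)}$. Let $E:\hat H\to\hat H$ be $E(\psi)=q_R^1\cdot\psi_{(0)}\cdot\beta S(q_R^2\psi_{(1)})$. The elements of $\mathcal L=E(\hat H)$ are called left cointegrals. An element $l\in H$ (resp. $r\in H$) is a left (resp. right) integral if $al=\epsilon(a)l$ (resp. $ra=\epsilon(a)r$) for all $a\in H$; it is normalized if its counit is $1$; a Haar integral is a normalized two-sided integral. Let $\lambda_e:=E(\epsilon)\in\mathcal L$. Then for every basis $(b_i)$ of $H$ with dual basis $(b^i)$ and all $a\in H$, $$\langle\lambda_e\mid a\rangle=\sum_i\langle b^i\mid a\,S^2(b_i)S(\beta)\alpha\rangle .$$ Moreover the following are equivalent: 1. $H$ is semisimple. 2. $H$ has a normalized left integral. 3. $H$ has a normalized right integral. 4. The left cointegral $\lambda_e$ is nonzero. 5. $H$ has a Haar integral. 6. $H$ is a separable $\mathbf k$-algebra, i.e. there is $P=\sum P^1\otimes P^2\in H\otimes H$ with $\sum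 P^1P^2=1$ and $\sum aP^1\otimes P^2=\sum P^1\otimes P^2a$ for all $a\in H$. In that case the Haar integral $e$ satisfies $\langle\lambda_e\mid e\rangle=1$. -/

import Mathlib

open scoped TensorProduct

noncomputable section

/-- A quasi-bialgebra structure `(Δ, ε, φ)` on the associative unital `k`-algebra `H`.
Threefold tensors are bracketed as `H ⊗ (H ⊗ H)`. -/
structure QuasiBialgebra (k H : Type*) [Field k] [Ring H] [Algebra k H] where
  /-- the coproduct `Δ` -/
  comul : H →ₐ[k] H ⊗[k] H
  /-- the counit `ε` -/
  counit : H →ₐ[k] k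
  /-- the invertible reassociator `φ` -/
  reassoc : (H ⊗[k] (H ⊗[k] H))ˣ
  /-- `(id ⊗ Δ)(Δ(a)) φ = φ (Δ ⊗ id)(Δ(a))` -/
  quasi_coassoc : ∀ a : H,
    Algebra.TensorProduct.map (AlgHom.id k H) comul (comul a) * (reassoc : H ⊗[k] (H ⊗[k] H)) =
      (reassoc : H ⊗[k] (H ⊗[k] H)) * Algebra.TensorProduct.assoc k k k H H H
        (Algebra.TensorProduct.map comul (AlgHom.id k H) (comul a))
  /-- `(id ⊗ id ⊗ Δ)(φ) (Δ ⊗ id ⊗ id)(φ) = (1 ⊗ φ) (id ⊗ Δ ⊗ id)(φ) (φ ⊗ 1)` -/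
  pentagon :
    Algebra.TensorProduct.map (AlgHom.id k H)
        (Algebra.TensorProduct.map (AlgHom.id k H) comul) (reassoc : H ⊗[k] (H ⊗[k] H)) *
      Algebra.TensorProduct.assoc k k k H H (H ⊗[k] H)
        (Algebra.TensorProduct.map comul (AlgHom.id k (H ⊗[k] H))
          (reassoc : H ⊗[k] (H ⊗[k] H))) =
    ((1 : H) ⊗ₜ[k] (reassoc : H ⊗[k] (H ⊗[k] H))) *
      Algebra.TensorProduct.map (AlgHom.id k H)
        ((Algebra.TensorProduct.assoc k k k H H H).toAlgHom.comp
          (Algebra.TensorProduct.map comul (AlgHom.id k H)))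
        (reassoc : H ⊗[k] (H ⊗[k] H)) *
      Algebra.TensorProduct.map (AlgHom.id k H)
        (Algebra.TensorProduct.assoc k k k H H H).toAlgHom
        (Algebra.TensorProduct.assoc k k k H (H ⊗[k] H) H
          ((reassoc : H ⊗[k] (H ⊗[k] H)) ⊗ₜ[k] (1 : H)))
  /-- `(ε ⊗ id) ∘ Δ = id` -/
  counit_left : ∀ a : H, Algebra.TensorProduct.lid k H
    (Algebra.TensorProduct.map counit (AlgHom.id k H) (comul a)) = a
  /-- `(id ⊗ ε) ∘ Δ = id` -/
  counit_right : ∀ a : H, Algebra.TensorProduct.rid k k H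
    (Algebra.TensorProduct.map (AlgHom.id k H) counit (comul a)) = a
  /-- `(id ⊗ ε ⊗ id)(φ) = 1 ⊗ 1` -/
  counit_reassoc :
    Algebra.TensorProduct.map (AlgHom.id k H)
      ((Algebra.TensorProduct.lid k H).toAlgHom.comp
        (Algebra.TensorProduct.map counit (AlgHom.id k H)))
      (reassoc : H ⊗[k] (H ⊗[k] H)) = 1

/-- A quasi-Hopf algebra structure on `H`: a quasi-bialgebra with an invertible
antipode `S` (a unital algebra anti-automorphism) and elements `α`, `β`. -/
structure QuasiHopfAlgebra (k H : Type*) [Field k] [Ring H] [Algebra k H] extends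
    QuasiBialgebra k H where
  /-- the invertible antipode `S` -/
  S : H ≃ₗ[k] H
  S_one : S 1 = 1
  S_mul : ∀ a b : H, S (a * b) = S b * S a
  /-- the element `α` -/
  α : H
  /-- the element `β` -/
  β : H
  /-- `S(a₍₁₎) α a₍₂₎ = α ε(a)` -/
  antipode_left : ∀ a : H,
    LinearMap.mul' k H (TensorProduct.map S.toLinearMap (LinearMap.mulLeft k α) (comul a)) =
      counit a • α
  /-- `a₍₁₎ β S(a₍₂₎) = β ε(a)` -/
  antipode_right : ∀ a : H,
    LinearMap.mul' k H (TensorProduct.map (LinearMap.mulRight k β) S.toLinearMap (comul a)) =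
      counit a • β
  /-- `X β S(Y) α Z = 1` for `φ = X ⊗ Y ⊗ Z` -/
  antipode_reassoc :
    LinearMap.mul' k H (TensorProduct.map (LinearMap.mulRight k β)
      (LinearMap.mul' k H ∘ₗ TensorProduct.map S.toLinearMap (LinearMap.mulLeft k α))
      (reassoc : H ⊗[k] (H ⊗[k] H))) = 1
  /-- `S(X̄) α Ȳ β S(Z̄) = 1` for `φ⁻¹ = X̄ ⊗ Ȳ ⊗ Z̄` -/
  antipode_reassoc_inv :
    LinearMap.mul' k H (TensorProduct.map S.toLinearMap
      (LinearMap.mul' k H ∘ₗ TensorProduct.map (LinearMap.mulLeft k α)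
        (LinearMap.mulLeft k β ∘ₗ S.toLinearMap))
      ((reassoc⁻¹ : (H ⊗[k] (H ⊗[k] H))ˣ) : H ⊗[k] (H ⊗[k] H))) = 1

namespace QuasiHopfAlgebra

variable {k H : Type*} [Field k] [Ring H] [Algebra k H] (Q : QuasiHopfAlgebra k H)

/-- `φ` as an element of `H ⊗ (H ⊗ H)`. -/
def φ : H ⊗[k] (H ⊗[k] H) := (Q.reassoc : H ⊗[k] (H ⊗[k] H))

/-- `φ⁻¹` as an element of `H ⊗ (H ⊗ H)`. -/
def φInv : H ⊗[k] (H ⊗[k] H) := ((Q.reassoc⁻¹ : (H ⊗[k] (H ⊗[k] H))ˣ) : H ⊗[k] (H ⊗[k] H))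

/-- The flip `x ⊗ y ↦ y ⊗ x` of `H ⊗ H`, that is `ψ ↦ ψ²¹`. -/
def flip : H ⊗[k] H →ₗ[k] H ⊗[k] H := (TensorProduct.comm k H H).toLinearMap

/-- `S ⊗ S`. -/
def SS : H ⊗[k] H →ₗ[k] H ⊗[k] H := TensorProduct.map Q.S.toLinearMap Q.S.toLinearMap

/-- `S⁻¹ ⊗ S⁻¹`. -/
def SSInv : H ⊗[k] H →ₗ[k] H ⊗[k] H :=
  TensorProduct.map Q.S.symm.toLinearMap Q.S.symm.toLinearMap

/-- `T ⊗ U ⊗ V ⊗ W = (1 ⊗ φ⁻¹) (id ⊗ id ⊗ Δ)(φ)`. -/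
def tuvw : H ⊗[k] (H ⊗[k] (H ⊗[k] H)) :=
  ((1 : H) ⊗ₜ[k] Q.φInv) *
    Algebra.TensorProduct.map (AlgHom.id k H)
      (Algebra.TensorProduct.map (AlgHom.id k H) Q.comul) Q.φ

/-- `γ = (S(U) ⊗ S(T)) (α ⊗ α) (V ⊗ W)`. -/
def γ : H ⊗[k] H :=
  LinearMap.mul' k (H ⊗[k] H)
    (TensorProduct.map (Q.SS ∘ₗ flip) (LinearMap.mulLeft k (Q.α ⊗ₜ[k] Q.α))
      ((TensorProduct.assoc k H H (H ⊗[k] H)).symm Q.tuvw))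

/-- The linear map `y ⊗ z ↦ y β S(z)`. -/
def mulβS : H ⊗[k] H →ₗ[k] H :=
  LinearMap.mul' k H ∘ₗ TensorProduct.map (LinearMap.mulRight k Q.β) Q.S.toLinearMap

/-- Drinfeld's twist `f = (S ⊗ S)(Δᵒᵖ(X̄)) γ Δ(Ȳ β S(Z̄))`. -/
def f : H ⊗[k] H :=
  LinearMap.mul' k (H ⊗[k] H)
    (TensorProduct.map
      (LinearMap.mulRight k Q.γ ∘ₗ Q.SS ∘ₗ flip ∘ₗ Q.comul.toLinearMap)
      (Q.comul.toLinearMap ∘ₗ Q.mulβS) Q.φInv)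

/-- `h = (S⁻¹ ⊗ S⁻¹)(f²¹)`. -/
def h : H ⊗[k] H := Q.SSInv (flip Q.f)

/-- The linear map `y ⊗ z ↦ S⁻¹(α z) y`. -/
def mulSInvα : H ⊗[k] H →ₗ[k] H :=
  LinearMap.mul' k H ∘ₗ
    TensorProduct.map (Q.S.symm.toLinearMap ∘ₗ LinearMap.mulLeft k Q.α) LinearMap.id ∘ₗ flip

/-- `q_R = X ⊗ S⁻¹(α Z) Y`. -/
def qR : H ⊗[k] H := TensorProduct.map LinearMap.id Q.mulSInvα Q.φ

/-- `p_R = X̄ ⊗ Ȳ β S(Z̄)`. -/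
def pR : H ⊗[k] H := TensorProduct.map LinearMap.id Q.mulβS Q.φInv

/-- `U = f⁻¹ (S ⊗ S)(q_R²¹)`. -/
def U : H ⊗[k] H := Ring.inverse Q.f * Q.SS (flip Q.qR)

/-- `V = (S⁻¹ ⊗ S⁻¹)(p_R²¹) h`. -/
def V : H ⊗[k] H := Q.SSInv (flip Q.pR) * Q.h

/-- The deformed coproduct `Δ̄(a) = V Δ(a) U`. -/
def comulBar : H →ₗ[k] H ⊗[k] H :=
  LinearMap.mulLeft k Q.V ∘ₗ LinearMap.mulRight k Q.U ∘ₗ Q.comul.toLinearMap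

/-- The left `H`-action on `H* = Hom(H, k)`: `⟨a · ψ | m⟩ = ⟨ψ | S⁻¹(a) m⟩`. -/
def dualLeft : H →ₗ[k] Module.Dual k H →ₗ[k] Module.Dual k H :=
  LinearMap.mk₂ k (fun a ψ => ψ ∘ₗ LinearMap.mulLeft k (Q.S.symm a))
    (fun _ _ _ => by ext; simp [add_mul]) (fun _ _ _ => by ext; simp)
    (fun _ _ _ => by ext; simp) (fun _ _ _ => by ext; simp)

/-- The right `H`-action on `H*`, as the map `b ↦ (ψ ↦ ψ · b)`: `⟨ψ · b | m⟩ = ⟨ψ | m S(b)⟩`. -/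
def dualRight : H →ₗ[k] Module.Dual k H →ₗ[k] Module.Dual k H :=
  LinearMap.mk₂ k (fun b ψ => ψ ∘ₗ LinearMap.mulRight k (Q.S b))
    (fun _ _ _ => by ext; simp [mul_add]) (fun _ _ _ => by ext; simp)
    (fun _ _ _ => by ext; simp) (fun _ _ _ => by ext; simp)

/-- The projection `E(m) = q_R¹ · m₍₀₎ · β S(q_R² m₍₁₎)` of a bimodule `M` with left action
`L a m = a · m`, right action `R b m = m · b` and right coaction `ρ(m) = m₍₀₎ ⊗ m₍₁₎`. -/
def coinvProj {M : Type*} [AddCommGroup M] [Module k M]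
    (L R : H →ₗ[k] M →ₗ[k] M) (ρ : M →ₗ[k] M ⊗[k] H) : M →ₗ[k] M :=
  TensorProduct.lift (R ∘ₗ LinearMap.mulLeft k Q.β ∘ₗ Q.S.toLinearMap).flip ∘ₗ
    TensorProduct.map (TensorProduct.lift L) (LinearMap.mul' k H) ∘ₗ
    (TensorProduct.tensorTensorTensorComm k H H M H).toLinearMap ∘ₗ
    TensorProduct.mk k (H ⊗[k] H) (M ⊗[k] H) Q.qR ∘ₗ ρ

section FiniteDimensional

variable [FiniteDimensional k H]

/-- The right coaction `ρ : H* → H* ⊗ H`; under `H* ⊗ H ≅ Hom(H, H)` the element `ρ(ψ)` is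
`m ↦ (id ⊗ ψ)(Δ̄(m))`. -/
def dualCoaction : Module.Dual k H →ₗ[k] Module.Dual k H ⊗[k] H where
  toFun ψ := (dualTensorHomEquiv k H H).symm
    ((TensorProduct.rid k H).toLinearMap ∘ₗ LinearMap.lTensor H ψ ∘ₗ Q.comulBar)
  map_add' ψ χ := by
    rw [← map_add]; congr 1; ext m; simp [LinearMap.lTensor_add]
  map_smul' c ψ := by
    rw [RingHom.id_apply, ← map_smul]; congr 1; ext m; simp [LinearMap.lTensor_smul]

/-- The projection `E : H* → H*` onto the left cointegrals. -/
def E : Module.Dual k H →ₗ[k] Module.Dual k H :=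
  Q.coinvProj Q.dualLeft Q.dualRight Q.dualCoaction

/-- The space `𝓛 = E(H*)` of left cointegrals on `H`, the coinvariants of `H*`. -/
def leftCointegrals : Submodule k (Module.Dual k H) := LinearMap.range Q.E

/-- `λ_e = E(ε)`. -/
def cointegralOfCounit : Module.Dual k H := Q.E Q.counit.toLinearMap

end FiniteDimensional

/-- `a l = ε(a) l` for all `a`. -/
def IsLeftIntegral (l : H) : Prop := ∀ a : H, a * l = Q.counit a • l

/-- `r a = r ε(a)` for all `a`. -/
def IsRightIntegral (r : H) : Prop := ∀ a : H, r * a = Q.counit a • r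

/-- A Haar integral is a normalized two-sided integral. -/
def IsHaarIntegral (e : H) : Prop :=
  Q.IsLeftIntegral e ∧ Q.IsRightIntegral e ∧ Q.counit e = 1

end QuasiHopfAlgebra

/-- The `k`-algebra `A` (not necessarily commutative) is separable: there is a separating
idempotent `P = ∑ P¹ ⊗ P²` in `A ⊗ A`, i.e. `∑ P¹ P² = 1` and `∑ a P¹ ⊗ P² = ∑ P¹ ⊗ P² a`. -/
def IsSeparableAlgebra (k A : Type*) [Field k] [Ring A] [Algebra k A] : Prop :=
  ∃ P : A ⊗[k] A, LinearMap.mul' k A P = 1 ∧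
    ∀ a : A, (a ⊗ₜ[k] (1 : A)) * P = P * ((1 : A) ⊗ₜ[k] a)

end

/-!
# Maschke's theorem for finite-dimensional quasi-Hopf algebras

*The twist.* The definition of `Δ̄`, hence of `λ_e = E(ε)`, contains the inverse of Drinfeld's
twist `f`, so one first shows that `f` is a unit (`isUnit_f`). Since `H ⊗ H` is finite-dimensional,
it suffices that the right ideal `f (H ⊗ H)` contains `1`. This ideal is stable under left
multiplication by `(S ⊗ S)(Δᵒᵖ(a))`, because `f Δ(S(a)) = (S ⊗ S)(Δᵒᵖ(a)) f` (`f_mul_comul_S`), and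
it contains `γ = f Δ(α)` (`f_mul_comul_α`). From `γ` and the pentagon one gets
`S(Y) α Z ⊗ S(X) α`, then `1 ⊗ S(b) α` for all `b`, and
finally `1 ⊗ S(X̄) α Ȳ β S(Z̄) = 1 ⊗ 1`. No inverse of `f` has to be exhibited. All these identities
are proved in the same way: a linear map on `H ⊗ H ⊗ H ⊗ H` that contracts legs by
`S(·) α ·` or `· β S(·)` absorbs the factors `(id ⊗ Δ ⊗ id)(φ)` etc. of the pentagon.

*The trace formula.* Applying `id ⊗ ε` to `Δ̄(m)` gives `S⁻¹(β) m α` (`counitR_comulBar`), and then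
`⟨λ_e | a⟩` is the trace of `x ↦ a S²(x) S(β) α`, by the cyclicity of the trace and
`q_R² S⁻¹(q_R¹ β) = 1` (`cointegralOfCounit_apply`).

*The equivalences.* If `H` is semisimple, a complement of the left ideal `ker ε` contains a
normalized left integral; `S` exchanges left and right integrals; normalized left and right
integrals agree, so they are Haar integrals. A normalized left integral `l` gives the separating
idempotent `q_R¹ l₍₁₎ β ⊗ S(q_R² l₍₂₎)`, and separable algebras are semisimple by averaging
projections. For a Haar integral `e` the operator `x ↦ e S²(x) S(β) α` is `x ↦ ε(x) e`, so
`⟨λ_e | e⟩ = 1`. Conversely, the trace `⟨λ_e | a⟩` is the value of a morphism of right `H`-modules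
`H* ⊗ H → k` at an invariant element of `H* ⊗ H`; this morphism lifts along `ε : H → k` to
`H* ⊗ H → H` (`contractLift`), so that there is a right integral of counit `⟨λ_e | a⟩`
(`exists_isRightIntegral_counit_eq`).
-/

noncomputable section

namespace QuasiHopfAlgebra

/-! ### Maps between tensor powers of `H` -/

section Induction

variable {k H : Type*} [Field k] [Ring H] [Algebra k H]

theorem tensor_induction₃ {P : H ⊗[k] (H ⊗[k] H) → Prop} (zero : P 0)
    (add : ∀ x y, P x → P y → P (x + y))
    (tmul : ∀ a b c, P (a ⊗ₜ (b ⊗ₜ c))) (p : H ⊗[k] (H ⊗[k] H)) : P p := by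
  induction p using TensorProduct.induction_on with
  | zero => exact zero
  | add x y hx hy => exact add x y hx hy
  | tmul a y =>
    induction y using TensorProduct.induction_on with
    | zero => simpa using zero
    | add x y hx hy => simpa [TensorProduct.tmul_add] using add _ _ hx hy
    | tmul b c => exact tmul a b c

theorem tensor_induction₄ {P : H ⊗[k] (H ⊗[k] (H ⊗[k] H)) → Prop} (zero : P 0)
    (add : ∀ x y, P x → P y → P (x + y))
    (tmul : ∀ a b c d, P (a ⊗ₜ (b ⊗ₜ (c ⊗ₜ d)))) (p : H ⊗[k] (H ⊗[k] (H ⊗[k] H))) : P p := by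
  induction p using TensorProduct.induction_on with
  | zero => exact zero
  | add x y hx hy => exact add x y hx hy
  | tmul a y =>
    refine tensor_induction₃ (P := fun y => P (a ⊗ₜ y)) (by simpa using zero) ?_ (tmul a) y
    intro x y hx hy
    simpa [TensorProduct.tmul_add] using add _ _ hx hy

-- A shortcut: instance search through four nested tensor products is otherwise too deep for
-- the rewriting lemmas about rings.
instance instRingTensor₄ : Ring (H ⊗[k] (H ⊗[k] (H ⊗[k] H))) := Algebra.TensorProduct.instRing

end Induction

variable {k H : Type*} [Field k] [Ring H] [Algebra k H] (Q : QuasiHopfAlgebra k H)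

/-- `ε ⊗ id` on `H ⊗ H`. -/
def counitL : H ⊗[k] H →ₐ[k] H :=
  (Algebra.TensorProduct.lid k H).toAlgHom.comp
    (Algebra.TensorProduct.map Q.counit (AlgHom.id k H))

/-- `id ⊗ ε` on `H ⊗ H`. -/
def counitR : H ⊗[k] H →ₐ[k] H :=
  (Algebra.TensorProduct.rid k k H).toAlgHom.comp
    (Algebra.TensorProduct.map (AlgHom.id k H) Q.counit)

/-- `ε ⊗ id ⊗ id` on `H ⊗ H ⊗ H`. -/
def counit₁ : H ⊗[k] (H ⊗[k] H) →ₐ[k] H ⊗[k] H :=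
  (Algebra.TensorProduct.lid k (H ⊗[k] H)).toAlgHom.comp
    (Algebra.TensorProduct.map Q.counit (AlgHom.id k (H ⊗[k] H)))

/-- `id ⊗ ε ⊗ id` on `H ⊗ H ⊗ H`. -/
def counit₂ : H ⊗[k] (H ⊗[k] H) →ₐ[k] H ⊗[k] H :=
  Algebra.TensorProduct.map (AlgHom.id k H) Q.counitL

/-- `id ⊗ id ⊗ ε` on `H ⊗ H ⊗ H`. -/
def counit₃ : H ⊗[k] (H ⊗[k] H) →ₐ[k] H ⊗[k] H :=
  Algebra.TensorProduct.map (AlgHom.id k H) Q.counitR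

/-- `ε ⊗ id ⊗ id ⊗ id` on `H ⊗ H ⊗ H ⊗ H`. -/
def counit₁₄ : H ⊗[k] (H ⊗[k] (H ⊗[k] H)) →ₐ[k] H ⊗[k] (H ⊗[k] H) :=
  (Algebra.TensorProduct.lid k (H ⊗[k] (H ⊗[k] H))).toAlgHom.comp
    (Algebra.TensorProduct.map Q.counit (AlgHom.id k (H ⊗[k] (H ⊗[k] H))))

/-- `Δ ⊗ id : H ⊗ H → H ⊗ H ⊗ H`. -/
def comulL : H ⊗[k] H →ₐ[k] H ⊗[k] (H ⊗[k] H) :=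
  (Algebra.TensorProduct.assoc k k k H H H).toAlgHom.comp
    (Algebra.TensorProduct.map Q.comul (AlgHom.id k H))

/-- `id ⊗ Δ : H ⊗ H → H ⊗ H ⊗ H`. -/
def comulR : H ⊗[k] H →ₐ[k] H ⊗[k] (H ⊗[k] H) :=
  Algebra.TensorProduct.map (AlgHom.id k H) Q.comul

/-- `Δ ⊗ id ⊗ id : H ⊗ H ⊗ H → H ⊗ H ⊗ H ⊗ H`. -/
def comul₁ : H ⊗[k] (H ⊗[k] H) →ₐ[k] H ⊗[k] (H ⊗[k] (H ⊗[k] H)) :=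
  (Algebra.TensorProduct.assoc k k k H H (H ⊗[k] H)).toAlgHom.comp
    (Algebra.TensorProduct.map Q.comul (AlgHom.id k (H ⊗[k] H)))

/-- `id ⊗ Δ ⊗ id : H ⊗ H ⊗ H → H ⊗ H ⊗ H ⊗ H`. -/
def comul₂ : H ⊗[k] (H ⊗[k] H) →ₐ[k] H ⊗[k] (H ⊗[k] (H ⊗[k] H)) :=
  Algebra.TensorProduct.map (AlgHom.id k H) Q.comulL

/-- `id ⊗ id ⊗ Δ : H ⊗ H ⊗ H → H ⊗ H ⊗ H ⊗ H`. -/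
def comul₃ : H ⊗[k] (H ⊗[k] H) →ₐ[k] H ⊗[k] (H ⊗[k] (H ⊗[k] H)) :=
  Algebra.TensorProduct.map (AlgHom.id k H) Q.comulR

/-- `p ↦ 1 ⊗ p` on `H ⊗ H ⊗ H`. -/
def unitL : H ⊗[k] (H ⊗[k] H) →ₐ[k] H ⊗[k] (H ⊗[k] (H ⊗[k] H)) :=
  Algebra.TensorProduct.includeRight

/-- `p ↦ p ⊗ 1` on `H ⊗ H ⊗ H`. -/
def unitR : H ⊗[k] (H ⊗[k] H) →ₐ[k] H ⊗[k] (H ⊗[k] (H ⊗[k] H)) :=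
  Algebra.TensorProduct.map (AlgHom.id k H)
    (Algebra.TensorProduct.map (AlgHom.id k H) Algebra.TensorProduct.includeLeft)

@[simp] theorem counitL_tmul (a b : H) : Q.counitL (a ⊗ₜ b) = Q.counit a • b := by
  simp [counitL]

@[simp] theorem counitR_tmul (a b : H) : Q.counitR (a ⊗ₜ b) = Q.counit b • a := by
  simp [counitR]

@[simp] theorem counit₁_tmul (a : H) (p : H ⊗[k] H) :
    Q.counit₁ (a ⊗ₜ p) = Q.counit a • p := by
  simp [counit₁]

@[simp] theorem counit₂_tmul (a : H) (p : H ⊗[k] H) :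
    Q.counit₂ (a ⊗ₜ p) = a ⊗ₜ Q.counitL p := by
  simp [counit₂]

@[simp] theorem counit₃_tmul (a : H) (p : H ⊗[k] H) :
    Q.counit₃ (a ⊗ₜ p) = a ⊗ₜ Q.counitR p := by
  simp [counit₃]

@[simp] theorem counit₁₄_tmul (a : H) (p : H ⊗[k] (H ⊗[k] H)) :
    Q.counit₁₄ (a ⊗ₜ p) = Q.counit a • p := by
  simp [counit₁₄]

theorem comulL_tmul (a b : H) :
    Q.comulL (a ⊗ₜ b) = TensorProduct.assoc k H H H (Q.comul a ⊗ₜ b) := rfl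

@[simp] theorem comulR_tmul (a b : H) : Q.comulR (a ⊗ₜ b) = a ⊗ₜ Q.comul b := rfl

theorem comul₁_tmul (a : H) (p : H ⊗[k] H) :
    Q.comul₁ (a ⊗ₜ p) = TensorProduct.assoc k H H (H ⊗[k] H) (Q.comul a ⊗ₜ p) := rfl

@[simp] theorem comul₂_tmul (a : H) (p : H ⊗[k] H) :
    Q.comul₂ (a ⊗ₜ p) = a ⊗ₜ Q.comulL p := rfl

@[simp] theorem comul₃_tmul (a : H) (p : H ⊗[k] H) :
    Q.comul₃ (a ⊗ₜ p) = a ⊗ₜ Q.comulR p := rfl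

@[simp] theorem unitL_apply (p : H ⊗[k] (H ⊗[k] H)) : unitL p = (1 : H) ⊗ₜ[k] p := rfl

@[simp] theorem unitR_tmul (a b c : H) :
    unitR (k := k) (a ⊗ₜ (b ⊗ₜ c)) = a ⊗ₜ (b ⊗ₜ (c ⊗ₜ 1)) := rfl

@[simp] theorem counitL_comul (a : H) : Q.counitL (Q.comul a) = a := Q.counit_left a

@[simp] theorem counitR_comul (a : H) : Q.counitR (Q.comul a) = a := Q.counit_right a

@[simp] theorem φ_mul_φInv : Q.φ * Q.φInv = 1 := Units.mul_inv Q.reassoc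

@[simp] theorem φInv_mul_φ : Q.φInv * Q.φ = 1 := Units.inv_mul Q.reassoc

theorem comulR_mul_φ (a : H) :
    Q.comulR (Q.comul a) * Q.φ = Q.φ * Q.comulL (Q.comul a) := Q.quasi_coassoc a

theorem φInv_mul_comulR (a : H) :
    Q.φInv * Q.comulR (Q.comul a) = Q.comulL (Q.comul a) * Q.φInv := by
  have h := congrArg (fun x => Q.φInv * x * Q.φInv) (Q.comulR_mul_φ a)
  simpa only [mul_assoc, φ_mul_φInv, mul_one, ← mul_assoc Q.φInv Q.φ, φInv_mul_φ, one_mul]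
    using h

theorem pentagon_φ :
    Q.comul₃ Q.φ * Q.comul₁ Q.φ = unitL Q.φ * Q.comul₂ Q.φ * unitR Q.φ := by
  have h (p : H ⊗[k] (H ⊗[k] H)) : unitR p = Algebra.TensorProduct.map (AlgHom.id k H)
        (Algebra.TensorProduct.assoc k k k H H H).toAlgHom
        (Algebra.TensorProduct.assoc k k k H (H ⊗[k] H) H (p ⊗ₜ[k] (1 : H))) := by
    induction p using tensor_induction₃ with
    | zero => simp
    | add x y hx hy => simp only [TensorProduct.add_tmul, map_add, hx, hy]
    | tmul a b c => rfl
  rw [h]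
  exact Q.pentagon

theorem counit₂_φ : Q.counit₂ Q.φ = 1 := Q.counit_reassoc

/-! ### Normalization of the reassociator and of the antipode -/

theorem map_φInv_eq_one {B : Type*} [Ring B] [Algebra k B]
    (F : H ⊗[k] (H ⊗[k] H) →ₐ[k] B) (h : F Q.φ = 1) : F Q.φInv = 1 := by
  have := map_mul F Q.φ Q.φInv
  rwa [φ_mul_φInv, map_one, h, one_mul, eq_comm] at this

theorem eq_one_of_map_φ_mul_self {B : Type*} [Ring B] [Algebra k B]
    (F : H ⊗[k] (H ⊗[k] H) →ₐ[k] B) (h : F Q.φ = F Q.φ * F Q.φ) : F Q.φ = 1 := by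
  have h1 : F Q.φ * F Q.φInv = 1 := by rw [← map_mul, φ_mul_φInv, map_one]
  have := congrArg (· * F Q.φInv) h
  simpa [mul_assoc, h1] using this.symm

theorem counit₁_counit₁₄_comul₁ (p : H ⊗[k] (H ⊗[k] H)) :
    Q.counit₁ (Q.counit₁₄ (Q.comul₁ p)) = Q.counit₁ p := by
  induction p using TensorProduct.induction_on with
  | zero => simp
  | add x y hx hy => simp only [map_add, hx, hy]
  | tmul a p =>
    have (d : H ⊗[k] H) : Q.counit₁ (Q.counit₁₄
        (TensorProduct.assoc k H H (H ⊗[k] H) (d ⊗ₜ p))) = Q.counit (Q.counitL d) • p := by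
      induction d using TensorProduct.induction_on with
      | zero => simp
      | add x y hx hy => simp only [TensorProduct.add_tmul, map_add, hx, hy, add_smul]
      | tmul x y => simp [smul_smul]
    rw [comul₁_tmul, this, counitL_comul, counit₁_tmul]

theorem counit₁_comulL (p : H ⊗[k] H) : Q.counit₁ (Q.comulL p) = p := by
  induction p using TensorProduct.induction_on with
  | zero => simp
  | add x y hx hy => simp only [map_add, hx, hy]
  | tmul a b =>
    have (d : H ⊗[k] H) : Q.counit₁ (TensorProduct.assoc k H H H (d ⊗ₜ b)) =
        Q.counitL d ⊗ₜ b := by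
      induction d using TensorProduct.induction_on with
      | zero => simp
      | add x y hx hy => simp only [TensorProduct.add_tmul, map_add, hx, hy]
      | tmul x y => simp [TensorProduct.smul_tmul']
    rw [comulL_tmul, this, counitL_comul]

theorem counit₃_comulR (p : H ⊗[k] H) : Q.counit₃ (Q.comulR p) = p := by
  induction p using TensorProduct.induction_on with
  | zero => simp
  | add x y hx hy => simp only [map_add, hx, hy]
  | tmul a b => simp

/-- `(ε ⊗ id ⊗ id)(φ) = 1 ⊗ 1`: applying `ε ⊗ ε ⊗ id ⊗ id` to the pentagon shows that this
invertible element is idempotent. -/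
theorem counit₁_φ : Q.counit₁ Q.φ = 1 := by
  apply Q.eq_one_of_map_φ_mul_self
  have h2 : Q.counitL (Q.counit₁ Q.φ) = 1 := by
    have (p : H ⊗[k] (H ⊗[k] H)) : Q.counitL (Q.counit₁ p) = Q.counitL (Q.counit₂ p) := by
      induction p using tensor_induction₃ with
      | zero => simp
      | add x y hx hy => simp only [map_add, hx, hy]
      | tmul a b c => simp [smul_smul, mul_comm]
    rw [this, counit₂_φ, map_one]
  have e1 (p : H ⊗[k] (H ⊗[k] H)) : Q.counit₁ (Q.counit₁₄ (Q.comul₃ p)) =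
      Q.comul (Q.counitL (Q.counit₁ p)) := by
    induction p using tensor_induction₃ with
    | zero => simp
    | add x y hx hy => simp only [map_add, hx, hy]
    | tmul a b c => simp
  have e2 (p : H ⊗[k] (H ⊗[k] H)) : Q.counit₁ (Q.counit₁₄ (Q.comul₂ p)) = Q.counit₁ p := by
    induction p using TensorProduct.induction_on with
    | zero => simp
    | add x y hx hy => simp only [map_add, hx, hy]
    | tmul a p => simp [counit₁_comulL]
  have e3 (p : H ⊗[k] (H ⊗[k] H)) : Q.counit₁ (Q.counit₁₄ (unitR p)) =
      Q.counitL (Q.counit₁ p) ⊗ₜ 1 := by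
    induction p using tensor_induction₃ with
    | zero => simp
    | add x y hx hy => simp only [map_add, hx, hy, TensorProduct.add_tmul]
    | tmul a b c => simp [TensorProduct.smul_tmul']
  have h := congrArg (fun x => Q.counit₁ (Q.counit₁₄ x)) Q.pentagon_φ
  simpa [e1, e2, e3, h2, counit₁_counit₁₄_comul₁, ← Algebra.TensorProduct.one_def] using h

/-- `(id ⊗ id ⊗ ε)(φ) = 1 ⊗ 1`, by applying `id ⊗ id ⊗ ε ⊗ ε` to the pentagon. -/
theorem counit₃_φ : Q.counit₃ Q.φ = 1 := by
  apply Q.eq_one_of_map_φ_mul_self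
  let C : H ⊗[k] (H ⊗[k] (H ⊗[k] H)) →ₐ[k] H ⊗[k] (H ⊗[k] H) :=
    Algebra.TensorProduct.map (AlgHom.id k H) Q.counit₃
  have hC (a : H) (p : H ⊗[k] (H ⊗[k] H)) : C (a ⊗ₜ p) = a ⊗ₜ Q.counit₃ p := rfl
  have h2 : Q.counitR (Q.counit₃ Q.φ) = 1 := by
    have (p : H ⊗[k] (H ⊗[k] H)) : Q.counitR (Q.counit₃ p) = Q.counitR (Q.counit₂ p) := by
      induction p using tensor_induction₃ with
      | zero => simp
      | add x y hx hy => simp only [map_add, hx, hy]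
      | tmul a b c => simp [mul_comm, smul_smul]
    rw [this, counit₂_φ, map_one]
  have e0 (p : H ⊗[k] (H ⊗[k] H)) : Q.counit₃ (C (Q.comul₃ p)) = Q.counit₃ p := by
    induction p using TensorProduct.induction_on with
    | zero => simp
    | add x y hx hy => simp only [map_add, hx, hy]
    | tmul a p => simp [hC, counit₃_comulR]
  have e1 (p : H ⊗[k] (H ⊗[k] H)) : Q.counit₃ (C (Q.comul₁ p)) =
      Q.comul (Q.counitR (Q.counit₃ p)) := by
    induction p using tensor_induction₃ with
    | zero => simp
    | add x y hx hy => simp only [map_add, hx, hy]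
    | tmul a b c =>
      rw [comul₁_tmul]
      have (d : H ⊗[k] H) : Q.counit₃ (C (TensorProduct.assoc k H H (H ⊗[k] H)
          (d ⊗ₜ (b ⊗ₜ c)))) = (Q.counit b * Q.counit c) • d := by
        induction d using TensorProduct.induction_on with
        | zero => simp
        | add x y hx hy => simp only [TensorProduct.add_tmul, map_add, hx, hy, smul_add]
        | tmul x y => simp [hC, mul_comm, smul_smul]
      rw [this]
      simp [mul_comm, smul_smul]
  have e2 (p : H ⊗[k] (H ⊗[k] H)) : Q.counit₃ (C (Q.comul₂ p)) = Q.counit₃ p := by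
    induction p using tensor_induction₃ with
    | zero => simp
    | add x y hx hy => simp only [map_add, hx, hy]
    | tmul a b c =>
      have (d : H ⊗[k] H) : Q.counit₃ (TensorProduct.assoc k H H H (d ⊗ₜ c)) =
          Q.counit c • d := by
        induction d using TensorProduct.induction_on with
        | zero => simp
        | add x y hx hy => simp only [TensorProduct.add_tmul, map_add, hx, hy, smul_add]
        | tmul x y => simp
      simp [hC, comulL_tmul, this]
  have e3 (p : H ⊗[k] (H ⊗[k] H)) : Q.counit₃ (C (unitR p)) = Q.counit₃ p := by
    induction p using tensor_induction₃ with
    | zero => simp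
    | add x y hx hy => simp only [map_add, hx, hy]
    | tmul a b c => simp [hC]
  have e4 : Q.counit₃ (C (unitL Q.φ)) = 1 := by
    simp [hC, h2, Algebra.TensorProduct.one_def]
  have h := congrArg (fun x => Q.counit₃ (C x)) Q.pentagon_φ
  simp only [map_mul, e0, e1, e2, e3, e4, h2, map_one, one_mul, mul_one] at h
  exact h

theorem counit₁_φInv : Q.counit₁ Q.φInv = 1 := Q.map_φInv_eq_one _ Q.counit₁_φ
theorem counit₂_φInv : Q.counit₂ Q.φInv = 1 := Q.map_φInv_eq_one _ Q.counit₂_φ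
theorem counit₃_φInv : Q.counit₃ Q.φInv = 1 := Q.map_φInv_eq_one _ Q.counit₃_φ

/-- The linear map `x ⊗ y ↦ S(x) α y`. -/
def mulSα : H ⊗[k] H →ₗ[k] H :=
  LinearMap.mul' k H ∘ₗ TensorProduct.map Q.S.toLinearMap (LinearMap.mulLeft k Q.α)

@[simp] theorem mulSα_tmul (a b : H) : Q.mulSα (a ⊗ₜ b) = Q.S a * Q.α * b := by
  simp [mulSα, mul_assoc]

@[simp] theorem mulβS_tmul (a b : H) : Q.mulβS (a ⊗ₜ b) = a * Q.β * Q.S b := by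
  simp [mulβS]

@[simp] theorem mulSInvα_tmul (a b : H) :
    Q.mulSInvα (a ⊗ₜ b) = Q.S.symm (Q.α * b) * a := by
  simp [mulSInvα, flip]

@[simp] theorem mulSα_comul (a : H) : Q.mulSα (Q.comul a) = Q.counit a • Q.α := Q.antipode_left a

@[simp] theorem mulβS_comul (a : H) : Q.mulβS (Q.comul a) = Q.counit a • Q.β :=
  Q.antipode_right a

@[simp] theorem S_symm_mul (a b : H) : Q.S.symm (a * b) = Q.S.symm b * Q.S.symm a := by
  rw [LinearEquiv.symm_apply_eq, S_mul]; simp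

@[simp] theorem S_symm_one : Q.S.symm 1 = 1 := by
  rw [LinearEquiv.symm_apply_eq, S_one]

theorem counit_S_mul_counit_α (a : H) :
    Q.counit (Q.S a) * Q.counit Q.α = Q.counit a * Q.counit Q.α := by
  have h := congrArg Q.counit (Q.mulSα_comul a)
  have e (d : H ⊗[k] H) : Q.counit (Q.mulSα d) =
      Q.counit (Q.S (Q.counitR d)) * Q.counit Q.α := by
    induction d using TensorProduct.induction_on with
    | zero => simp
    | add x y hx hy => simp only [map_add, hx, hy, add_mul]
    | tmul x y => simp; ring
  rw [e] at h
  simpa using h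

theorem counit_β_mul_counit_α : Q.counit Q.β * Q.counit Q.α = 1 := by
  have h := congrArg Q.counit Q.antipode_reassoc
  have e (p : H ⊗[k] (H ⊗[k] H)) : Q.counit (LinearMap.mul' k H
      (TensorProduct.map (LinearMap.mulRight k Q.β)
        (LinearMap.mul' k H ∘ₗ TensorProduct.map Q.S.toLinearMap (LinearMap.mulLeft k Q.α)) p)) =
      Q.counit Q.β * Q.counit Q.α * Q.counit (Q.S (Q.counitR (Q.counit₁ p))) := by
    induction p using tensor_induction₃ with
    | zero => simp
    | add x y hx hy => simp only [map_add, hx, hy, mul_add]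
    | tmul x y z => simp; ring
  rw [e] at h
  change _ * Q.counit (Q.S (Q.counitR (Q.counit₁ Q.φ))) = _ at h
  rw [counit₁_φ] at h
  simpa [Q.S_one] using h

@[simp] theorem counit_S (a : H) : Q.counit (Q.S a) = Q.counit a := by
  have h0 : Q.counit Q.α ≠ 0 := right_ne_zero_of_mul_eq_one Q.counit_β_mul_counit_α
  exact mul_right_cancel₀ h0 (Q.counit_S_mul_counit_α a)

@[simp] theorem counit_S_symm (a : H) : Q.counit (Q.S.symm a) = Q.counit a := by
  rw [← Q.counit_S, LinearEquiv.apply_symm_apply]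

/-! ### Invertibility of the Drinfeld twist -/

/-- The anti-multiplicative map `(S ⊗ S) ∘ Δᵒᵖ`. -/
def opComulS : H →ₗ[k] H ⊗[k] H := Q.SS ∘ₗ flip ∘ₗ Q.comul.toLinearMap

@[simp] theorem SS_flip_tmul (a b : H) : Q.SS (flip (a ⊗ₜ b)) = Q.S b ⊗ₜ Q.S a := by
  simp [SS, flip]

theorem SS_flip_mul (x y : H ⊗[k] H) :
    Q.SS (flip (x * y)) = Q.SS (flip y) * Q.SS (flip x) := by
  induction x using TensorProduct.induction_on with
  | zero => simp
  | add x x' hx hx' => simp only [add_mul, mul_add, map_add, hx, hx']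
  | tmul a b =>
    induction y using TensorProduct.induction_on with
    | zero => simp
    | add y y' hy hy' => simp only [add_mul, mul_add, map_add, hy, hy']
    | tmul c d => simp [Q.S_mul]

theorem opComulS_apply (a : H) : Q.opComulS a = Q.SS (flip (Q.comul a)) := rfl

theorem opComulS_mul (a b : H) : Q.opComulS (a * b) = Q.opComulS b * Q.opComulS a := by
  simp only [opComulS_apply, map_mul, SS_flip_mul]

@[simp] theorem opComulS_one : Q.opComulS 1 = 1 := by
  simp [opComulS_apply, Algebra.TensorProduct.one_def, Q.S_one]

/-- The linear map `t ⊗ u ⊗ v ⊗ w ↦ S(u) α v ⊗ S(t) α w`. -/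
def gammaMap : H ⊗[k] (H ⊗[k] (H ⊗[k] H)) →ₗ[k] H ⊗[k] H :=
  LinearMap.mul' k (H ⊗[k] H) ∘ₗ
    (TensorProduct.map (Q.SS ∘ₗ flip) (LinearMap.mulLeft k (Q.α ⊗ₜ[k] Q.α)) ∘ₗ
      (TensorProduct.assoc k H H (H ⊗[k] H)).symm.toLinearMap)

@[simp] theorem gammaMap_tmul (t u v w : H) :
    Q.gammaMap (t ⊗ₜ (u ⊗ₜ (v ⊗ₜ w))) = (Q.S u * Q.α * v) ⊗ₜ (Q.S t * Q.α * w) := by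
  simp [gammaMap, mul_assoc]

theorem γ_eq : Q.γ = Q.gammaMap Q.tuvw := rfl

theorem tuvw_eq : Q.tuvw = unitL Q.φInv * Q.comul₃ Q.φ := rfl

theorem tuvw_mul_comul₁ :
    Q.tuvw * Q.comul₁ Q.φ = Q.comul₂ Q.φ * unitR Q.φ := by
  rw [tuvw_eq, mul_assoc, pentagon_φ, ← mul_assoc, ← mul_assoc, ← map_mul, φInv_mul_φ, map_one,
    one_mul]

/-- The embedding `a ⊗ b ↦ a ⊗ 1 ⊗ 1 ⊗ b`. -/
def outer : H ⊗[k] H →ₐ[k] H ⊗[k] (H ⊗[k] (H ⊗[k] H)) :=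
  Algebra.TensorProduct.map (AlgHom.id k H)
    (Algebra.TensorProduct.includeRight.comp Algebra.TensorProduct.includeRight)

@[simp] theorem outer_tmul (a b : H) :
    outer (k := k) (a ⊗ₜ b) = a ⊗ₜ ((1 : H) ⊗ₜ ((1 : H) ⊗ₜ b)) := rfl

/-- The contraction `S(b₍₁₎) α b₍₂₎ = ε(b) α` of the two inner legs. -/
theorem gammaMap_comul₂_mul (p : H ⊗[k] (H ⊗[k] H)) (q : H ⊗[k] (H ⊗[k] (H ⊗[k] H))) :
    Q.gammaMap (Q.comul₂ p * q) = Q.gammaMap (outer (Q.counit₂ p) * q) := by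
  induction p using tensor_induction₃ with
  | zero => simp
  | add x y hx hy => simp only [map_add, add_mul, hx, hy]
  | tmul a b c =>
    induction q using tensor_induction₄ with
    | zero => simp
    | add x y hx hy => simp only [map_add, mul_add, hx, hy]
    | tmul t u v w =>
      have (d : H ⊗[k] H) : Q.gammaMap (a ⊗ₜ TensorProduct.assoc k H H H (d ⊗ₜ c) *
          t ⊗ₜ (u ⊗ₜ (v ⊗ₜ w))) = (Q.S u * Q.mulSα d * v) ⊗ₜ (Q.S (a * t) * Q.α * (c * w)) := by
        induction d using TensorProduct.induction_on with
        | zero => simp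
        | add x y hx hy =>
          simp only [TensorProduct.add_tmul, map_add, TensorProduct.tmul_add, add_mul, mul_add,
            hx, hy]
        | tmul x y => simp [Q.S_mul, mul_assoc]
      rw [comul₂_tmul, comulL_tmul, this]
      simp [TensorProduct.smul_tmul']

/-- The contraction `S(a₍₁₎) α a₍₂₎ = ε(a) α` of the two outer legs. -/
theorem gammaMap_outer_comul_mul (a : H) (q : H ⊗[k] (H ⊗[k] (H ⊗[k] H))) :
    Q.gammaMap (outer (Q.comul a) * q) = Q.counit a • Q.gammaMap q := by
  induction q using tensor_induction₄ with
  | zero => simp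
  | add x y hx hy => simp only [map_add, mul_add, hx, hy, smul_add]
  | tmul t u v w =>
    have (d : H ⊗[k] H) : Q.gammaMap (outer d * t ⊗ₜ (u ⊗ₜ (v ⊗ₜ w))) =
        (Q.S u * Q.α * v) ⊗ₜ (Q.S t * Q.mulSα d * w) := by
      induction d using TensorProduct.induction_on with
      | zero => simp
      | add x y hx hy =>
        simp only [map_add, TensorProduct.tmul_add, add_mul, mul_add, hx, hy]
      | tmul x y => simp [Q.S_mul, mul_assoc]
    rw [this]
    simp

theorem gammaMap_mul_assoc (q : H ⊗[k] (H ⊗[k] (H ⊗[k] H))) (d e : H ⊗[k] H) :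
    Q.gammaMap (q * TensorProduct.assoc k H H (H ⊗[k] H) (d ⊗ₜ e)) =
      Q.SS (flip d) * Q.gammaMap q * e := by
  induction q using tensor_induction₄ with
  | zero => simp
  | add x y hx hy => simp only [map_add, add_mul, mul_add, hx, hy]
  | tmul t u v w =>
    induction d using TensorProduct.induction_on with
    | zero => simp
    | add x y hx hy => simp only [TensorProduct.add_tmul, map_add, add_mul, mul_add, hx, hy]
    | tmul x y =>
      induction e using TensorProduct.induction_on with
      | zero => simp
      | add x y hx hy => simp only [TensorProduct.tmul_add, map_add, mul_add, hx, hy]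
      | tmul x' y' => simp [Q.S_mul, mul_assoc]

theorem gammaMap_mul_comul₁ (q : H ⊗[k] (H ⊗[k] (H ⊗[k] H))) (a : H) (e : H ⊗[k] H) :
    Q.gammaMap (q * Q.comul₁ (a ⊗ₜ e)) = Q.opComulS a * Q.gammaMap q * e := by
  rw [comul₁_tmul, gammaMap_mul_assoc, opComulS_apply]

/-- The linear map `a ⊗ b ↦ (S ⊗ S)(Δᵒᵖ(a)) γ Δ(b)`. -/
def opSγ : H ⊗[k] H →ₗ[k] H ⊗[k] H :=
  LinearMap.mul' k (H ⊗[k] H) ∘ₗ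
    TensorProduct.map (LinearMap.mulRight k Q.γ ∘ₗ Q.opComulS) Q.comul.toLinearMap

@[simp] theorem opSγ_tmul (a b : H) :
    Q.opSγ (a ⊗ₜ b) = Q.opComulS a * Q.γ * Q.comul b := by
  simp [opSγ]

/-- `(S ⊗ S)(Δᵒᵖ(a₍₁₎)) γ Δ(a₍₂₎) = ε(a) γ`. -/
theorem opSγ_comul (a : H) : Q.opSγ (Q.comul a) = Q.counit a • Q.γ := by
  have e1 (x : H ⊗[k] H) : Q.opSγ x = Q.gammaMap (Q.tuvw * Q.comul₃ (Q.comulL x)) := by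
    induction x using TensorProduct.induction_on with
    | zero => simp
    | add x y hx hy => simp only [map_add, mul_add, hx, hy]
    | tmul a b =>
      have (d : H ⊗[k] H) : Q.comul₃ (TensorProduct.assoc k H H H (d ⊗ₜ b)) =
          TensorProduct.assoc k H H (H ⊗[k] H) (d ⊗ₜ Q.comul b) := by
        induction d using TensorProduct.induction_on with
        | zero => simp
        | add x y hx hy => simp only [TensorProduct.add_tmul, map_add, hx, hy]
        | tmul x y => simp
      rw [comulL_tmul, this, ← comul₁_tmul, gammaMap_mul_comul₁, ← γ_eq, opSγ_tmul]
  have e2 (x : H ⊗[k] H) : unitL Q.φInv * Q.comul₃ (Q.comulR x) =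
      Q.comul₂ (Q.comulR x) * unitL Q.φInv := by
    induction x using TensorProduct.induction_on with
    | zero => simp
    | add x y hx hy => simp only [map_add, mul_add, add_mul, hx, hy]
    | tmul a b => simp [φInv_mul_comulR]
  have e3 (x : H ⊗[k] H) : Q.counit₂ (Q.comulR x) = x := by
    induction x using TensorProduct.induction_on with
    | zero => simp
    | add x y hx hy => simp only [map_add, hx, hy]
    | tmul a b => simp
  rw [e1, tuvw_eq, mul_assoc, ← map_mul, ← comulR_mul_φ, map_mul Q.comul₃, ← mul_assoc, e2,
    mul_assoc, gammaMap_comul₂_mul, e3, gammaMap_outer_comul_mul, ← tuvw_eq, γ_eq]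

/-- The linear map `x ⊗ y ⊗ z ↦ (S ⊗ S)(Δᵒᵖ(x)) γ Δ(y β S(z))`. -/
def twistMap : H ⊗[k] (H ⊗[k] H) →ₗ[k] H ⊗[k] H :=
  LinearMap.mul' k (H ⊗[k] H) ∘ₗ
    TensorProduct.map (LinearMap.mulRight k Q.γ ∘ₗ Q.opComulS) (Q.comul.toLinearMap ∘ₗ Q.mulβS)

@[simp] theorem twistMap_tmul (x : H) (p : H ⊗[k] H) :
    Q.twistMap (x ⊗ₜ p) = Q.opComulS x * Q.γ * Q.comul (Q.mulβS p) := by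
  simp [twistMap]

theorem f_eq : Q.f = Q.twistMap Q.φInv := rfl

theorem mulβS_tmul_mul (y z : H) (d : H ⊗[k] H) :
    Q.mulβS (y ⊗ₜ z * d) = y * Q.mulβS d * Q.S z := by
  induction d using TensorProduct.induction_on with
  | zero => simp
  | add a b ha hb => simp only [mul_add, map_add, add_mul, ha, hb]
  | tmul a b => simp [Q.S_mul, mul_assoc]

theorem mulβS_mul_comul (p : H ⊗[k] H) (b : H) :
    Q.mulβS (p * Q.comul b) = Q.counit b • Q.mulβS p := by
  induction p using TensorProduct.induction_on with
  | zero => simp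
  | add x y hx hy => simp only [add_mul, map_add, smul_add, hx, hy]
  | tmul y z => simp [mulβS_tmul_mul]

theorem mulSα_mul_tmul (d : H ⊗[k] H) (y z : H) :
    Q.mulSα (d * y ⊗ₜ z) = Q.S y * Q.mulSα d * z := by
  induction d using TensorProduct.induction_on with
  | zero => simp
  | add a b ha hb => simp only [mul_add, map_add, add_mul, ha, hb]
  | tmul a b => simp [Q.S_mul, mul_assoc]

theorem mulSα_comul_mul (b : H) (p : H ⊗[k] H) :
    Q.mulSα (Q.comul b * p) = Q.counit b • Q.mulSα p := by
  induction p using TensorProduct.induction_on with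
  | zero => simp
  | add x y hx hy => simp only [mul_add, map_add, smul_add, hx, hy]
  | tmul y z => simp [mulSα_mul_tmul]

/-- `f` intertwines `Δ ∘ S` with `(S ⊗ S) ∘ Δᵒᵖ`. -/
theorem f_mul_comul_S (a : H) : Q.f * Q.comul (Q.S a) = Q.opComulS a * Q.f := by
  have e1 (x : H ⊗[k] H) (p : H ⊗[k] (H ⊗[k] H)) : Q.twistMap (p * Q.comulR x) =
      Q.opComulS (Q.counitR x) * Q.twistMap p := by
    induction x using TensorProduct.induction_on with
    | zero => simp
    | add x y hx hy => simp only [map_add, mul_add, add_mul, hx, hy]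
    | tmul a b =>
      induction p using TensorProduct.induction_on with
      | zero => simp
      | add x y hx hy => simp only [map_add, mul_add, add_mul, hx, hy]
      | tmul x p => simp [mulβS_mul_comul, opComulS_mul, mul_assoc]
  have e2 (x : H ⊗[k] H) (p : H ⊗[k] (H ⊗[k] H)) : Q.twistMap (Q.comulL x * p) =
      Q.twistMap p * Q.comul (Q.S (Q.counitL x)) := by
    induction x using TensorProduct.induction_on with
    | zero => simp
    | add x y hx hy => simp only [map_add, mul_add, add_mul, hx, hy]
    | tmul a b =>
      induction p using tensor_induction₃ with
      | zero => simp
      | add x y hx hy => simp only [map_add, mul_add, add_mul, hx, hy]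
      | tmul x y z =>
        have (d : H ⊗[k] H) : Q.twistMap (TensorProduct.assoc k H H H (d ⊗ₜ b) *
            x ⊗ₜ (y ⊗ₜ z)) = Q.opComulS x * Q.opSγ d * Q.comul (y * Q.β * Q.S (b * z)) := by
          induction d using TensorProduct.induction_on with
          | zero => simp
          | add x y hx hy => simp only [TensorProduct.add_tmul, map_add, mul_add, add_mul, hx, hy]
          | tmul x y => simp [mul_assoc, opComulS_mul]
        rw [comulL_tmul, this]
        simp [opSγ_comul, Q.S_mul, mul_assoc]
  have h := congrArg Q.twistMap (Q.φInv_mul_comulR a)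
  rw [e1, e2, counitR_comul, counitL_comul] at h
  rw [f_eq, h]

/-- The embedding `a ⊗ b ↦ a ⊗ b ⊗ 1 ⊗ 1`. -/
def leftPair : H ⊗[k] H →ₐ[k] H ⊗[k] (H ⊗[k] (H ⊗[k] H)) :=
  Algebra.TensorProduct.map (AlgHom.id k H) Algebra.TensorProduct.includeLeft

@[simp] theorem leftPair_tmul (a b : H) :
    leftPair (k := k) (a ⊗ₜ b) = a ⊗ₜ (b ⊗ₜ (1 : H ⊗[k] H)) := rfl

/-- The embedding `p ↦ 1 ⊗ 1 ⊗ p`. -/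
def rightPair : H ⊗[k] H →ₐ[k] H ⊗[k] (H ⊗[k] (H ⊗[k] H)) :=
  Algebra.TensorProduct.includeRight.comp Algebra.TensorProduct.includeRight

@[simp] theorem rightPair_apply (p : H ⊗[k] H) :
    rightPair p = (1 : H) ⊗ₜ[k] ((1 : H) ⊗ₜ[k] p) := rfl

/-- The linear map `x ⊗ y ⊗ z ↦ x β S(y) α z`. -/
def mulβSα : H ⊗[k] (H ⊗[k] H) →ₗ[k] H :=
  LinearMap.mul' k H ∘ₗ TensorProduct.map (LinearMap.mulRight k Q.β) Q.mulSα

@[simp] theorem mulβSα_tmul (x : H) (p : H ⊗[k] H) :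
    Q.mulβSα (x ⊗ₜ p) = x * Q.β * Q.mulSα p := by
  simp [mulβSα]

theorem mulβSα_φ : Q.mulβSα Q.φ = 1 := Q.antipode_reassoc

/-- The linear map `x ⊗ y ⊗ z ⊗ w ↦ (S ⊗ S)(Δᵒᵖ(x)) γ Δ(y β S(z) α w)`. -/
def twistMapα : H ⊗[k] (H ⊗[k] (H ⊗[k] H)) →ₗ[k] H ⊗[k] H :=
  LinearMap.mul' k (H ⊗[k] H) ∘ₗ
    TensorProduct.map (LinearMap.mulRight k Q.γ ∘ₗ Q.opComulS) (Q.comul.toLinearMap ∘ₗ Q.mulβSα)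

@[simp] theorem twistMapα_tmul (x : H) (p : H ⊗[k] (H ⊗[k] H)) :
    Q.twistMapα (x ⊗ₜ p) = Q.opComulS x * Q.γ * Q.comul (Q.mulβSα p) := by
  simp [twistMapα]

theorem twistMapα_mul_comul₂ (p : H ⊗[k] (H ⊗[k] H)) (q : H ⊗[k] (H ⊗[k] (H ⊗[k] H))) :
    Q.twistMapα (q * Q.comul₂ p) = Q.twistMapα (q * outer (Q.counit₂ p)) := by
  induction p using tensor_induction₃ with
  | zero => simp
  | add x y hx hy => simp only [map_add, mul_add, hx, hy]
  | tmul a b c =>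
    induction q using tensor_induction₄ with
    | zero => simp
    | add x y hx hy => simp only [map_add, add_mul, hx, hy]
    | tmul x y z w =>
      have (d : H ⊗[k] H) : Q.mulβSα (y ⊗ₜ (z ⊗ₜ w) * TensorProduct.assoc k H H H (d ⊗ₜ c)) =
          y * Q.mulβS d * Q.S z * Q.α * (w * c) := by
        induction d using TensorProduct.induction_on with
        | zero => simp
        | add x y hx hy => simp only [TensorProduct.add_tmul, map_add, mul_add, add_mul, hx, hy]
        | tmul x y => simp [mul_assoc, Q.S_mul]
      rw [comul₂_tmul, comulL_tmul, Algebra.TensorProduct.tmul_mul_tmul, twistMapα_tmul, this]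
      simp [mul_assoc, TensorProduct.smul_tmul']

theorem twistMapα_comul₃_mul (p : H ⊗[k] (H ⊗[k] H)) (q : H ⊗[k] (H ⊗[k] (H ⊗[k] H))) :
    Q.twistMapα (Q.comul₃ p * q) = Q.twistMapα (leftPair (Q.counit₃ p) * q) := by
  induction p using tensor_induction₃ with
  | zero => simp
  | add x y hx hy => simp only [map_add, add_mul, hx, hy]
  | tmul a b c =>
    induction q using tensor_induction₄ with
    | zero => simp
    | add x y hx hy => simp only [map_add, mul_add, hx, hy]
    | tmul x y z w => simp [mulSα_comul_mul, -mulSα_tmul, TensorProduct.smul_tmul']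

theorem twistMapα_comul₁_mul (p : H ⊗[k] (H ⊗[k] H)) (q : H ⊗[k] (H ⊗[k] (H ⊗[k] H))) :
    Q.twistMapα (Q.comul₁ p * q) = Q.twistMapα (rightPair (Q.counit₁ p) * q) := by
  induction p using TensorProduct.induction_on with
  | zero => simp
  | add x y hx hy => simp only [map_add, add_mul, hx, hy]
  | tmul a e =>
    induction q using tensor_induction₄ with
    | zero => simp
    | add x y hx hy => simp only [map_add, mul_add, hx, hy]
    | tmul x y z w =>
      have (d : H ⊗[k] H) : Q.twistMapα (TensorProduct.assoc k H H (H ⊗[k] H) (d ⊗ₜ e) *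
          x ⊗ₜ (y ⊗ₜ (z ⊗ₜ w))) = Q.opComulS x * Q.opSγ d *
            Q.comul (y * Q.β * Q.mulSα (e * z ⊗ₜ w)) := by
        induction d using TensorProduct.induction_on with
        | zero => simp
        | add x y hx hy => simp only [TensorProduct.add_tmul, map_add, mul_add, add_mul, hx, hy]
        | tmul x y => simp [mul_assoc, opComulS_mul]
      rw [comul₁_tmul, this]
      simp [opSγ_comul, mul_assoc, TensorProduct.smul_tmul']

theorem twistMapα_unitR (p : H ⊗[k] (H ⊗[k] H)) :
    Q.twistMapα (unitR p) = Q.twistMap p * Q.comul Q.α := by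
  induction p using tensor_induction₃ with
  | zero => simp
  | add x y hx hy => simp only [map_add, add_mul, hx, hy]
  | tmul a b c => simp [mul_assoc]

/-- `f Δ(α) = γ`: evaluate `x ⊗ y ⊗ z ⊗ w ↦ (S ⊗ S)(Δᵒᵖ(x)) γ Δ(y β S(z) α w)` on both sides of
the pentagon, solved for `(1 ⊗ φ) (id ⊗ Δ ⊗ id)(φ)`. -/
theorem f_mul_comul_α : Q.f * Q.comul Q.α = Q.γ := by
  have h1 : unitR Q.φ * unitR Q.φInv = 1 := by rw [← map_mul, φ_mul_φInv, map_one]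
  have h : Q.comul₃ Q.φ * (Q.comul₁ Q.φ * unitR Q.φInv) = unitL Q.φ * Q.comul₂ Q.φ := by
    rw [← mul_assoc, pentagon_φ, mul_assoc, h1, mul_one]
  have h' := congrArg Q.twistMapα h
  rw [twistMapα_comul₃_mul, counit₃_φ, map_one, one_mul, twistMapα_comul₁_mul, counit₁_φ, map_one,
    one_mul, twistMapα_unitR, twistMapα_mul_comul₂, counit₂_φ, map_one, mul_one] at h'
  rw [f_eq, h']
  simp [mulβSα_φ]

/-- The linear map `u ⊗ v ⊗ y ↦ S(u) α v β S(y)`. -/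
def mulSαβS : H ⊗[k] (H ⊗[k] H) →ₗ[k] H :=
  LinearMap.mul' k H ∘ₗ TensorProduct.map Q.S.toLinearMap (LinearMap.mulLeft k Q.α ∘ₗ Q.mulβS)

@[simp] theorem mulSαβS_tmul (u : H) (p : H ⊗[k] H) :
    Q.mulSαβS (u ⊗ₜ p) = Q.S u * Q.α * Q.mulβS p := by
  simp [mulSαβS, mul_assoc]

theorem mulSαβS_φInv : Q.mulSαβS Q.φInv = 1 := by
  have (p : H ⊗[k] (H ⊗[k] H)) : Q.mulSαβS p = LinearMap.mul' k H
      (TensorProduct.map Q.S.toLinearMap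
        (LinearMap.mul' k H ∘ₗ TensorProduct.map (LinearMap.mulLeft k Q.α)
          (LinearMap.mulLeft k Q.β ∘ₗ Q.S.toLinearMap)) p) := by
    induction p using tensor_induction₃ with
    | zero => simp
    | add x y hx hy => simp only [map_add, hx, hy]
    | tmul a b c => simp [mul_assoc]
  rw [this]
  exact Q.antipode_reassoc_inv

/-- The linear map `t ⊗ u ⊗ v ⊗ y ↦ S(u) α v β S(y) ⊗ S(t)`. -/
def nestedMap : H ⊗[k] (H ⊗[k] (H ⊗[k] H)) →ₗ[k] H ⊗[k] H :=
  flip ∘ₗ TensorProduct.map Q.S.toLinearMap Q.mulSαβS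

@[simp] theorem nestedMap_tmul (t : H) (p : H ⊗[k] (H ⊗[k] H)) :
    Q.nestedMap (t ⊗ₜ p) = Q.mulSαβS p ⊗ₜ Q.S t := by
  simp [nestedMap, flip]

theorem nestedMap_comul₂_mul (p : H ⊗[k] (H ⊗[k] H)) (q : H ⊗[k] (H ⊗[k] (H ⊗[k] H))) :
    Q.nestedMap (Q.comul₂ p * q) = Q.nestedMap (outer (Q.counit₂ p) * q) := by
  induction p using tensor_induction₃ with
  | zero => simp
  | add x y hx hy => simp only [map_add, add_mul, hx, hy]
  | tmul a b c =>
    induction q using tensor_induction₄ with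
    | zero => simp
    | add x y hx hy => simp only [map_add, mul_add, hx, hy]
    | tmul t u v y =>
      have (d : H ⊗[k] H) : Q.mulSαβS (TensorProduct.assoc k H H H (d ⊗ₜ c) *
          u ⊗ₜ (v ⊗ₜ y)) = Q.S u * Q.mulSα d * v * Q.β * Q.S (c * y) := by
        induction d using TensorProduct.induction_on with
        | zero => simp
        | add x y hx hy => simp only [TensorProduct.add_tmul, map_add, mul_add, add_mul, hx, hy]
        | tmul x y => simp [mul_assoc, Q.S_mul]
      rw [comul₂_tmul, comulL_tmul, Algebra.TensorProduct.tmul_mul_tmul, nestedMap_tmul, this]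
      simp [mul_assoc, TensorProduct.smul_tmul']

theorem nestedMap_mul_comul₃ (p : H ⊗[k] (H ⊗[k] H)) (q : H ⊗[k] (H ⊗[k] (H ⊗[k] H))) :
    Q.nestedMap (q * Q.comul₃ p) = Q.nestedMap (q * leftPair (Q.counit₃ p)) := by
  induction p using tensor_induction₃ with
  | zero => simp
  | add x y hx hy => simp only [map_add, mul_add, hx, hy]
  | tmul a b c =>
    induction q using tensor_induction₄ with
    | zero => simp
    | add x y hx hy => simp only [map_add, add_mul, hx, hy]
    | tmul t u v y => simp [mulβS_mul_comul, -mulβS_tmul, TensorProduct.smul_tmul']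

theorem nestedMap_tmul_one_mul (b : H) (q : H ⊗[k] (H ⊗[k] (H ⊗[k] H))) :
    Q.nestedMap (b ⊗ₜ 1 * q) = Q.nestedMap q * 1 ⊗ₜ Q.S b := by
  induction q using TensorProduct.induction_on with
  | zero => simp
  | add x y hx hy => simp only [map_add, mul_add, add_mul, hx, hy]
  | tmul t p => simp [Q.S_mul]

/-- `S(Y x₍₂₎) α Z y β S(z) ⊗ S(X x₍₁₎) = 1 ⊗ 1` for `φ = X ⊗ Y ⊗ Z` and `φ⁻¹ = x ⊗ y ⊗ z`. -/
theorem nestedMap_unitR_mul_comul₁ : Q.nestedMap (unitR Q.φ * Q.comul₁ Q.φInv) = 1 := by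
  have h1 : Q.comul₁ Q.φ * Q.comul₁ Q.φInv = 1 := by rw [← map_mul, φ_mul_φInv, map_one]
  have h2 : Q.comul₂ Q.φInv * Q.comul₂ Q.φ = 1 := by rw [← map_mul, φInv_mul_φ, map_one]
  have h3 : unitL Q.φInv * unitL Q.φ = 1 := by rw [← map_mul, φInv_mul_φ, map_one]
  have h : unitR Q.φ * Q.comul₁ Q.φInv =
      Q.comul₂ Q.φInv * (unitL Q.φInv * Q.comul₃ Q.φ) := by
    calc unitR Q.φ * Q.comul₁ Q.φInv
        = Q.comul₂ Q.φInv * ((unitL Q.φInv * unitL Q.φ) * (Q.comul₂ Q.φ *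
            (unitR Q.φ * Q.comul₁ Q.φInv))) := by
          rw [h3, one_mul, ← mul_assoc, h2, one_mul]
      _ = Q.comul₂ Q.φInv * (unitL Q.φInv * ((unitL Q.φ * Q.comul₂ Q.φ * unitR Q.φ) *
            Q.comul₁ Q.φInv)) := by simp only [mul_assoc]
      _ = _ := by rw [← pentagon_φ, mul_assoc (Q.comul₃ Q.φ), h1, mul_one]
  rw [h, nestedMap_comul₂_mul, counit₂_φInv, map_one, one_mul, nestedMap_mul_comul₃, counit₃_φ,
    map_one, mul_one]
  simp [mulSαβS_φInv, Q.S_one, Algebra.TensorProduct.one_def]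

theorem nestedMap_unitR_mul_comul₁_tmul (r : H ⊗[k] (H ⊗[k] H)) (a : H) (e : H ⊗[k] H) :
    Q.nestedMap (unitR r * Q.comul₁ (a ⊗ₜ e)) * 1 ⊗ₜ Q.α =
      Q.opComulS a * Q.gammaMap (unitR r) * Q.mulβS e ⊗ₜ 1 := by
  rw [comul₁_tmul, opComulS_apply]
  induction r using tensor_induction₃ with
  | zero => simp
  | add x y hx hy => simp only [map_add, mul_add, add_mul, hx, hy]
  | tmul x y z =>
    generalize Q.comul a = d
    induction d using TensorProduct.induction_on with
    | zero => simp
    | add x y hx hy => simp only [TensorProduct.add_tmul, map_add, mul_add, add_mul, hx, hy]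
    | tmul d d' =>
      induction e using TensorProduct.induction_on with
      | zero => simp
      | add x y hx hy =>
        simp only [TensorProduct.tmul_add, TensorProduct.add_tmul, map_add, mul_add, add_mul,
          hx, hy]
      | tmul e e' => simp [mul_assoc, Q.S_mul]

/-- The right ideal `f (H ⊗ H)`. -/
def twistIdeal : Submodule k (H ⊗[k] H) := LinearMap.range (LinearMap.mulLeft k Q.f)

theorem mul_mem_twistIdeal {x : H ⊗[k] H} (hx : x ∈ Q.twistIdeal) (y : H ⊗[k] H) :
    x * y ∈ Q.twistIdeal := by
  obtain ⟨c, rfl⟩ := hx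
  exact ⟨c * y, by simp [mul_assoc]⟩

theorem opComulS_mul_mem_twistIdeal (a : H) {x : H ⊗[k] H} (hx : x ∈ Q.twistIdeal) :
    Q.opComulS a * x ∈ Q.twistIdeal := by
  obtain ⟨c, rfl⟩ := hx
  exact ⟨Q.comul (Q.S a) * c, by simp [← mul_assoc, f_mul_comul_S]⟩

theorem γ_mem_twistIdeal : Q.γ ∈ Q.twistIdeal := ⟨Q.comul Q.α, Q.f_mul_comul_α⟩

/-- For `φ = X ⊗ Y ⊗ Z` the element `S(Y) α Z ⊗ S(X) α` equals
`∑ (S ⊗ S)(Δᵒᵖ(X)) γ (Y ⊗ Z)` by the pentagon. -/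
theorem gammaMap_unitR_φ_mem_twistIdeal : Q.gammaMap (unitR Q.φ) ∈ Q.twistIdeal := by
  have h : Q.gammaMap (unitR Q.φ) = Q.gammaMap (Q.tuvw * Q.comul₁ Q.φ) := by
    rw [tuvw_mul_comul₁, gammaMap_comul₂_mul, counit₂_φ, map_one, one_mul]
  rw [h]
  generalize Q.φ = p
  induction p using TensorProduct.induction_on with
  | zero => simp
  | add x y hx hy => simpa only [map_add, mul_add] using add_mem hx hy
  | tmul a e =>
    rw [gammaMap_mul_comul₁, ← γ_eq]
    exact Q.mul_mem_twistIdeal (Q.opComulS_mul_mem_twistIdeal a Q.γ_mem_twistIdeal) e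

/-- The element `1 ⊗ S(b) α` arises from `S(Y) α Z ⊗ S(X) α` by inserting `(Δ ⊗ id)(Δ(b)) φ⁻¹` and
moving `Δ(b)` past `φ`. -/
theorem one_tmul_S_mul_α_mem_twistIdeal (b : H) :
    (1 : H) ⊗ₜ[k] (Q.S b * Q.α) ∈ Q.twistIdeal := by
  let j : H ⊗[k] H →ₐ[k] H ⊗[k] (H ⊗[k] H) :=
    Algebra.TensorProduct.map (AlgHom.id k H) Algebra.TensorProduct.includeLeft
  have hj (x y : H) : j (x ⊗ₜ y) = x ⊗ₜ (y ⊗ₜ 1) := rfl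
  have mem (p : H ⊗[k] (H ⊗[k] H)) :
      Q.nestedMap (unitR Q.φ * Q.comul₁ p) * 1 ⊗ₜ Q.α ∈ Q.twistIdeal := by
    induction p using TensorProduct.induction_on with
    | zero => simp
    | add x y hx hy => simpa only [map_add, mul_add, add_mul] using add_mem hx hy
    | tmul a e =>
      rw [nestedMap_unitR_mul_comul₁_tmul]
      exact Q.mul_mem_twistIdeal
        (Q.opComulS_mul_mem_twistIdeal a Q.gammaMap_unitR_φ_mem_twistIdeal) _
  have h1 (x : H ⊗[k] H) : Q.comul₁ (j x) = unitR (Q.comulL x) := by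
    induction x using TensorProduct.induction_on with
    | zero => simp
    | add x y hx hy => simp only [map_add, hx, hy]
    | tmul a c =>
      rw [hj, comul₁_tmul, comulL_tmul]
      generalize Q.comul a = d
      induction d using TensorProduct.induction_on with
      | zero => simp
      | add x y hx hy => simp only [TensorProduct.add_tmul, map_add, hx, hy]
      | tmul x y => rfl
  have h2 (x : H ⊗[k] H) : unitR (Q.comulR x) = Q.comul₂ (j x) := by
    induction x using TensorProduct.induction_on with
    | zero => simp
    | add x y hx hy => simp only [map_add, hx, hy]
    | tmul a c =>
      rw [hj, comul₂_tmul, comulR_tmul, comulL_tmul]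
      generalize Q.comul c = d
      induction d using TensorProduct.induction_on with
      | zero => simp
      | add x y hx hy =>
        simp only [TensorProduct.add_tmul, TensorProduct.tmul_add, map_add, hx, hy]
      | tmul x y => rfl
  have h3 (x : H ⊗[k] H) : Q.counit₂ (j x) = Q.counitR x ⊗ₜ 1 := by
    induction x using TensorProduct.induction_on with
    | zero => simp
    | add x y hx hy => simp only [map_add, TensorProduct.add_tmul, hx, hy]
    | tmul a c => simp [hj, TensorProduct.smul_tmul']
  have h := mem (j (Q.comul b) * Q.φInv)
  rw [map_mul Q.comul₁, ← mul_assoc, h1, ← map_mul, ← comulR_mul_φ, map_mul unitR, h2, mul_assoc,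
    nestedMap_comul₂_mul, h3, counitR_comul, outer_tmul] at h
  simpa only [← Algebra.TensorProduct.one_def, nestedMap_tmul_one_mul,
    nestedMap_unitR_mul_comul₁, one_mul, Algebra.TensorProduct.tmul_mul_tmul] using h

theorem one_mem_twistIdeal : (1 : H ⊗[k] H) ∈ Q.twistIdeal := by
  have h (p : H ⊗[k] (H ⊗[k] H)) : (1 : H) ⊗ₜ[k] Q.mulSαβS p ∈ Q.twistIdeal := by
    induction p using TensorProduct.induction_on with
    | zero => simp
    | add x y hx hy => simpa only [map_add, TensorProduct.tmul_add] using add_mem hx hy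
    | tmul b e =>
      simpa using Q.mul_mem_twistIdeal (Q.one_tmul_S_mul_α_mem_twistIdeal b) (1 ⊗ₜ Q.mulβS e)
  simpa only [mulSαβS_φInv, ← Algebra.TensorProduct.one_def] using h Q.φInv

theorem isUnit_f [FiniteDimensional k H] : IsUnit Q.f := by
  obtain ⟨c, hc⟩ := Q.one_mem_twistIdeal
  have : IsArtinianRing (H ⊗[k] H) := IsArtinianRing.of_finite k _
  exact IsUnit.of_mul_eq_one c hc

/-! ### The counit of the twist and of the deformed coproduct -/

theorem counit₂_comulR (p : H ⊗[k] H) : Q.counit₂ (Q.comulR p) = p := by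
  induction p using TensorProduct.induction_on with
  | zero => simp
  | add x y hx hy => simp only [map_add, hx, hy]
  | tmul a b => simp

theorem counitR_gammaMap (q : H ⊗[k] (H ⊗[k] (H ⊗[k] H))) :
    Q.counitR (Q.gammaMap q) = Q.counit Q.α • Q.mulSα (Q.counit₃ (Q.counit₁₄ q)) := by
  induction q using tensor_induction₄ with
  | zero => simp
  | add x y hx hy => simp only [map_add, smul_add, hx, hy]
  | tmul t u v w =>
    simp only [gammaMap_tmul, counitR_tmul, map_mul, counit_S, counit₁₄_tmul, map_smul,
      counit₃_tmul, TensorProduct.tmul_smul, mulSα_tmul, smul_smul]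
    ring_nf

theorem counitR_γ : Q.counitR Q.γ = Q.counit Q.α • Q.α := by
  have e (p : H ⊗[k] (H ⊗[k] H)) : Q.counit₁₄ (Q.comul₃ p) = Q.comulR (Q.counit₁ p) := by
    induction p using TensorProduct.induction_on with
    | zero => simp
    | add x y hx hy => simp only [map_add, hx, hy]
    | tmul a p => simp
  have e' : Q.counit₁₄ (unitL Q.φInv) = Q.φInv := by simp
  rw [γ_eq, counitR_gammaMap, tuvw_eq, map_mul, map_mul, e, e', counit₁_φ, counit₃_φInv,
    counit₃_comulR]
  simp [Algebra.TensorProduct.one_def, Q.S_one]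

/-- `id ⊗ ε ⊗ id ⊗ id` on `H ⊗ H ⊗ H ⊗ H`. -/
def counit₂₄ : H ⊗[k] (H ⊗[k] (H ⊗[k] H)) →ₐ[k] H ⊗[k] (H ⊗[k] H) :=
  Algebra.TensorProduct.map (AlgHom.id k H) Q.counit₁

@[simp] theorem counit₂₄_tmul (a : H) (p : H ⊗[k] (H ⊗[k] H)) :
    Q.counit₂₄ (a ⊗ₜ p) = a ⊗ₜ Q.counit₁ p := rfl

theorem counitL_gammaMap (q : H ⊗[k] (H ⊗[k] (H ⊗[k] H))) :
    Q.counitL (Q.gammaMap q) = Q.counit Q.α • Q.mulSα (Q.counit₂ (Q.counit₂₄ q)) := by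
  induction q using tensor_induction₄ with
  | zero => simp
  | add x y hx hy => simp only [map_add, smul_add, hx, hy]
  | tmul t u v w =>
    simp only [gammaMap_tmul, counitL_tmul, map_mul, counit_S, counit₂₄_tmul, counit₁_tmul,
      map_smul, counit₂_tmul, TensorProduct.tmul_smul, mulSα_tmul, smul_smul]
    ring_nf

theorem counitL_γ : Q.counitL Q.γ = Q.counit Q.α • Q.α := by
  have e (p : H ⊗[k] (H ⊗[k] H)) : Q.counit₂₄ (Q.comul₃ p) = Q.comulR (Q.counit₂ p) := by
    induction p using tensor_induction₃ with
    | zero => simp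
    | add x y hx hy => simp only [map_add, hx, hy]
    | tmul a b c => simp
  have e' : Q.counit₂₄ (unitL Q.φInv) = 1 := by
    simp [counit₁_φInv, Algebra.TensorProduct.one_def]
  rw [γ_eq, counitL_gammaMap, tuvw_eq, map_mul, map_mul, e, e', map_one, counit₂_φ,
    counit₂_comulR]
  simp [Algebra.TensorProduct.one_def, Q.S_one]

theorem counitR_SS_flip (x : H ⊗[k] H) : Q.counitR (Q.SS (flip x)) = Q.S (Q.counitL x) := by
  induction x using TensorProduct.induction_on with
  | zero => simp
  | add x y hx hy => simp only [map_add, hx, hy]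
  | tmul a b => simp

theorem counitL_SS_flip (x : H ⊗[k] H) : Q.counitL (Q.SS (flip x)) = Q.S (Q.counitR x) := by
  induction x using TensorProduct.induction_on with
  | zero => simp
  | add x y hx hy => simp only [map_add, hx, hy]
  | tmul a b => simp

theorem counitR_SSInv_flip (x : H ⊗[k] H) :
    Q.counitR (Q.SSInv (flip x)) = Q.S.symm (Q.counitL x) := by
  induction x using TensorProduct.induction_on with
  | zero => simp
  | add x y hx hy => simp only [map_add, hx, hy]
  | tmul a b => simp [SSInv, flip]

theorem counitR_f : Q.counitR Q.f = Q.counit Q.α • 1 := by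
  have e (p : H ⊗[k] (H ⊗[k] H)) :
      Q.counitR (Q.twistMap p) = Q.counit Q.α • Q.mulSαβS p := by
    induction p using TensorProduct.induction_on with
    | zero => simp
    | add x y hx hy => simp only [map_add, hx, hy, smul_add]
    | tmul a p => simp [opComulS_apply, counitR_SS_flip, counitR_γ]
  rw [f_eq, e, mulSαβS_φInv]

theorem counitL_f : Q.counitL Q.f = Q.counit Q.α • 1 := by
  have e (p : H ⊗[k] (H ⊗[k] H)) :
      Q.counitL (Q.twistMap p) = Q.counit Q.α • Q.mulSαβS p := by
    induction p using TensorProduct.induction_on with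
    | zero => simp
    | add x y hx hy => simp only [map_add, hx, hy, smul_add]
    | tmul a p => simp [opComulS_apply, counitL_SS_flip, counitL_γ]
  rw [f_eq, e, mulSαβS_φInv]

theorem counitL_qR : Q.counitL Q.qR = Q.S.symm Q.α := by
  have e (p : H ⊗[k] (H ⊗[k] H)) :
      Q.counitL (TensorProduct.map LinearMap.id Q.mulSInvα p) = Q.mulSInvα (Q.counit₁ p) := by
    induction p using TensorProduct.induction_on with
    | zero => simp
    | add x y hx hy => simp only [map_add, hx, hy]
    | tmul a p => simp
  rw [qR, e, counit₁_φ]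
  simp [Algebra.TensorProduct.one_def]

theorem counitL_pR : Q.counitL Q.pR = Q.β := by
  have e (p : H ⊗[k] (H ⊗[k] H)) :
      Q.counitL (TensorProduct.map LinearMap.id Q.mulβS p) = Q.mulβS (Q.counit₁ p) := by
    induction p using TensorProduct.induction_on with
    | zero => simp
    | add x y hx hy => simp only [map_add, hx, hy]
    | tmul a p => simp
  rw [pR, e, counit₁_φInv]
  simp [Algebra.TensorProduct.one_def, Q.S_one]

theorem counitR_V : Q.counitR Q.V = Q.counit Q.α • Q.S.symm Q.β := by
  simp [V, h, counitR_SSInv_flip, counitL_pR, counitL_f]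

section FiniteDimensional

variable [FiniteDimensional k H]

theorem counitR_inverse_f : Q.counitR (Ring.inverse Q.f) = Q.counit Q.β • 1 := by
  have h := congrArg Q.counitR (Ring.inverse_mul_cancel Q.f Q.isUnit_f)
  rw [map_mul, counitR_f, map_one, mul_smul_comm, mul_one] at h
  have h' := congrArg (Q.counit Q.β • ·) h
  simpa [smul_smul, counit_β_mul_counit_α] using h'

theorem counitR_U : Q.counitR Q.U = Q.counit Q.β • Q.α := by
  simp [U, counitR_inverse_f, counitR_SS_flip, counitL_qR]

/-- `(id ⊗ ε)(Δ̄(m)) = S⁻¹(β) m α`. -/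
theorem counitR_comulBar (m : H) : Q.counitR (Q.comulBar m) = Q.S.symm Q.β * (m * Q.α) := by
  simp [comulBar, counitR_U, counitR_V, smul_smul, counit_β_mul_counit_α]

end FiniteDimensional

/-! ### The trace formula for `λ_e` -/

/-- `q_R² S⁻¹(q_R¹ β) = 1`. -/
theorem qR_mul_S_symm_β : TensorProduct.lift ((LinearMap.mul k H).flip ∘ₗ
    Q.S.symm.toLinearMap ∘ₗ LinearMap.mulRight k Q.β) Q.qR = 1 := by
  have e (p : H ⊗[k] (H ⊗[k] H)) : TensorProduct.lift ((LinearMap.mul k H).flip ∘ₗ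
      Q.S.symm.toLinearMap ∘ₗ LinearMap.mulRight k Q.β)
        (TensorProduct.map LinearMap.id Q.mulSInvα p) = Q.S.symm (Q.mulβSα p) := by
    induction p using tensor_induction₃ with
    | zero => simp
    | add x y hx hy => simp only [map_add, hx, hy]
    | tmul a b c => simp [mul_assoc]
  rw [qR, e, mulβSα_φ, S_symm_one]

/-- The operator `x ↦ a S²(x) S(β) α`, whose trace is `⟨λ_e | a⟩`. -/
def cointegralOperator (a : H) : H →ₗ[k] H :=
  LinearMap.mulLeft k a ∘ₗ LinearMap.mulRight k (Q.S Q.β * Q.α) ∘ₗ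
    Q.S.toLinearMap ∘ₗ Q.S.toLinearMap

@[simp] theorem cointegralOperator_apply (a x : H) :
    Q.cointegralOperator a x = a * (Q.S (Q.S x) * (Q.S Q.β * Q.α)) := rfl

section FiniteDimensional

variable [FiniteDimensional k H]

theorem trace_dualTensorHom_comp (χ : Module.Dual k H) (y : H) (G : H →ₗ[k] H) :
    LinearMap.trace k H (dualTensorHom k H H (χ ⊗ₜ y) ∘ₗ G) = χ (G y) := by
  have : dualTensorHom k H H (χ ⊗ₜ y) ∘ₗ G = dualTensorHom k H H ((χ ∘ₗ G) ⊗ₜ y) := by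
    ext; simp
  rw [this, LinearMap.trace_eq_contract_apply]
  simp

theorem coinvProj_eq_trace (q₁ q₂ a : H) (τ : Module.Dual k H ⊗[k] H) :
    TensorProduct.lift (Q.dualRight ∘ₗ LinearMap.mulLeft k Q.β ∘ₗ Q.S.toLinearMap).flip
      (TensorProduct.map (TensorProduct.lift Q.dualLeft) (LinearMap.mul' k H)
        (TensorProduct.tensorTensorTensorComm k H H (Module.Dual k H) H ((q₁ ⊗ₜ q₂) ⊗ₜ τ))) a =
    LinearMap.trace k H (dualTensorHom k H H τ ∘ₗ (LinearMap.mulLeft k (Q.S.symm q₁ * a) ∘ₗ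
      LinearMap.mulRight k (Q.S Q.β) ∘ₗ Q.S.toLinearMap ∘ₗ Q.S.toLinearMap ∘ₗ
        LinearMap.mulLeft k q₂)) := by
  induction τ using TensorProduct.induction_on with
  | zero => simp
  | add x y hx hy =>
    simp only [TensorProduct.tmul_add, map_add, LinearMap.add_apply, hx, hy, LinearMap.add_comp]
  | tmul χ y =>
    rw [trace_dualTensorHom_comp]
    simp [dualLeft, dualRight, Q.S_mul, mul_assoc]

theorem dualTensorHom_dualCoaction_counit :
    dualTensorHom k H H (Q.dualCoaction Q.counit.toLinearMap) =
      LinearMap.mulLeft k (Q.S.symm Q.β) ∘ₗ LinearMap.mulRight k Q.α := by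
  have e : (TensorProduct.rid k H).toLinearMap ∘ₗ LinearMap.lTensor H Q.counit.toLinearMap =
      Q.counitR.toLinearMap := by
    ext; simp
  have h : dualTensorHom k H H (Q.dualCoaction Q.counit.toLinearMap) =
      Q.counitR.toLinearMap ∘ₗ Q.comulBar := by
    rw [← e]
    exact (dualTensorHomEquiv k H H).apply_symm_apply _
  rw [h]
  ext m
  simp [counitR_comulBar]

/-- Moving the left multiplication by `S⁻¹(q_R¹ β)` around the trace turns the factor in front of
`x` into `q_R² S⁻¹(q_R¹ β) = 1`. -/
theorem cointegralOfCounit_apply (a : H) :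
    Q.cointegralOfCounit a = LinearMap.trace k H (Q.cointegralOperator a) := by
  have e (q : H ⊗[k] H) :
      TensorProduct.lift (Q.dualRight ∘ₗ LinearMap.mulLeft k Q.β ∘ₗ Q.S.toLinearMap).flip
        (TensorProduct.map (TensorProduct.lift Q.dualLeft) (LinearMap.mul' k H)
          (TensorProduct.tensorTensorTensorComm k H H (Module.Dual k H) H
            (q ⊗ₜ Q.dualCoaction Q.counit.toLinearMap))) a =
      LinearMap.trace k H (Q.cointegralOperator a ∘ₗ LinearMap.mul k H
        (TensorProduct.lift ((LinearMap.mul k H).flip ∘ₗ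
          Q.S.symm.toLinearMap ∘ₗ LinearMap.mulRight k Q.β) q)) := by
    induction q using TensorProduct.induction_on with
    | zero => simp
    | add x y hx hy =>
      simp only [TensorProduct.add_tmul, map_add, LinearMap.add_apply, hx, hy, LinearMap.comp_add]
    | tmul q₁ q₂ =>
      rw [coinvProj_eq_trace, dualTensorHom_dualCoaction_counit]
      let A : Module.End k H := LinearMap.mulLeft k (Q.S.symm (q₁ * Q.β))
      let B : Module.End k H := Q.cointegralOperator a ∘ₗ LinearMap.mulLeft k q₂
      have h1 : (LinearMap.mulLeft k (Q.S.symm Q.β) ∘ₗ LinearMap.mulRight k Q.α) ∘ₗ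
          (LinearMap.mulLeft k (Q.S.symm q₁ * a) ∘ₗ
            LinearMap.mulRight k (Q.S Q.β) ∘ₗ Q.S.toLinearMap ∘ₗ Q.S.toLinearMap ∘ₗ
              LinearMap.mulLeft k q₂) = A * B := by
        ext x; simp [A, B, mul_assoc]
      have h2 : Q.cointegralOperator a ∘ₗ LinearMap.mul k H
          (TensorProduct.lift ((LinearMap.mul k H).flip ∘ₗ
            Q.S.symm.toLinearMap ∘ₗ LinearMap.mulRight k Q.β) (q₁ ⊗ₜ q₂)) = B * A := by
        ext x; simp [A, B, mul_assoc]
      rw [h1, h2, LinearMap.trace_mul_comm]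
  have h := e Q.qR
  rw [qR_mul_S_symm_β] at h
  have h1 : LinearMap.mul k H 1 = LinearMap.id := by ext; simp
  rw [h1, LinearMap.comp_id] at h
  exact h

theorem cointegralOfCounit_apply_basis {ι : Type*} [Fintype ι] (b : Module.Basis ι k H) (a : H) :
    Q.cointegralOfCounit a =
      ∑ i, b.coord i (a * (Q.S (Q.S (b i)) * Q.S Q.β * Q.α)) := by
  classical
  rw [cointegralOfCounit_apply, LinearMap.trace_eq_matrix_trace k b, Matrix.trace]
  simp [LinearMap.toMatrix_apply, mul_assoc]

end FiniteDimensional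
end QuasiHopfAlgebra

section Separable

variable {k A : Type*} [Field k] [Ring A] [Algebra k A]

/-- A separating idempotent `P` averages a `k`-linear projection `π` onto a left ideal to the
`A`-linear projection `x ↦ ∑ P¹ π(P² x)`. -/
theorem IsSeparableAlgebra.isSemisimpleRing (h : IsSeparableAlgebra k A) : IsSemisimpleRing A := by
  obtain ⟨P, hP, hcomm⟩ := h
  refine (isSemisimpleModule_iff A A).mpr ⟨fun N => ?_⟩
  obtain ⟨g, hg⟩ := (N.restrictScalars k).subtype.exists_leftInverse_of_injective
    (LinearMap.ker_eq_bot.mpr Subtype.val_injective)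
  let π : A →ₗ[k] A := (N.restrictScalars k).subtype ∘ₗ g
  have hπ_mem (x : A) : π x ∈ N := (g x).2
  have hπ (x : A) (hx : x ∈ N) : π x = x :=
    congrArg Subtype.val (LinearMap.congr_fun hg ⟨x, hx⟩)
  let avg (x : A) : A ⊗[k] A →ₗ[k] A :=
    LinearMap.mul' k A ∘ₗ TensorProduct.map LinearMap.id (π ∘ₗ LinearMap.mulRight k x)
  have avg_tmul (x a b : A) : avg x (a ⊗ₜ b) = a * π (b * x) := by simp [avg]
  have avg_add (x y : A) (p : A ⊗[k] A) : avg (x + y) p = avg x p + avg y p := by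
    induction p using TensorProduct.induction_on with
    | zero => simp
    | add p q hp hq => rw [map_add, map_add, map_add, hp, hq]; abel
    | tmul a b => simp [avg_tmul, mul_add]
  have avg_left (x c : A) (p : A ⊗[k] A) : c * avg x p = avg x ((c ⊗ₜ 1) * p) := by
    induction p using TensorProduct.induction_on with
    | zero => simp
    | add p q hp hq => rw [map_add, mul_add, hp, hq, mul_add, map_add]
    | tmul a b => simp [avg_tmul, mul_assoc]
  have avg_right (x c : A) (p : A ⊗[k] A) : avg (c * x) p = avg x (p * (1 ⊗ₜ c)) := by
    induction p using TensorProduct.induction_on with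
    | zero => simp
    | add p q hp hq => rw [map_add, hp, hq, add_mul, map_add]
    | tmul a b => simp [avg_tmul, mul_assoc]
  have avg_mem (x : A) (p : A ⊗[k] A) : avg x p ∈ N := by
    induction p using TensorProduct.induction_on with
    | zero => simp
    | add p q hp hq => rw [map_add]; exact add_mem hp hq
    | tmul a b => rw [avg_tmul]; exact N.smul_mem a (hπ_mem _)
  have avg_eq (x : A) (hx : x ∈ N) (p : A ⊗[k] A) : avg x p = LinearMap.mul' k A p * x := by
    induction p using TensorProduct.induction_on with
    | zero => simp
    | add p q hp hq => rw [map_add, hp, hq, map_add, add_mul]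
    | tmul a b =>
      have hb : π (b * x) = b * x := hπ _ (N.smul_mem b hx)
      rw [avg_tmul, hb, LinearMap.mul'_apply, mul_assoc]
  let F : A →ₗ[A] N :=
    { toFun := fun x => ⟨avg x P, avg_mem x P⟩
      map_add' := fun x y => Subtype.ext (avg_add x y P)
      map_smul' := fun c x => Subtype.ext <| by
        change avg (c * x) P = c * avg x P
        rw [avg_left, hcomm, avg_right] }
  refine ⟨LinearMap.ker F, LinearMap.isCompl_of_proj fun x => Subtype.ext ?_⟩
  change avg x P = x
  rw [avg_eq x x.2, hP, one_mul]

end Separable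

namespace QuasiHopfAlgebra
variable {k H : Type*} [Field k] [Ring H] [Algebra k H] {Q : QuasiHopfAlgebra k H}

/-! ### Normalized integrals -/

/-- A left ideal complementary to the kernel of `ε` contains a normalized left integral. -/
theorem exists_isLeftIntegral_of_isSemisimpleRing [IsSemisimpleRing H]
    (Q : QuasiHopfAlgebra k H) : ∃ l : H, Q.IsLeftIntegral l ∧ Q.counit l = 1 := by
  obtain ⟨J, hJ⟩ := exists_isCompl (RingHom.ker Q.counit : Submodule H H)
  obtain ⟨i, hi, l, hl, hil⟩ := Submodule.mem_sup.mp
    (hJ.sup_eq_top ▸ Submodule.mem_top : (1 : H) ∈ RingHom.ker Q.counit ⊔ J)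
  have hl1 : Q.counit l = 1 := by
    have h := congrArg Q.counit hil
    rwa [map_add, (RingHom.mem_ker).mp hi, zero_add, map_one] at h
  refine ⟨l, fun a => ?_, hl1⟩
  have h1 : a * l - Q.counit a • l ∈ J := by
    refine sub_mem (J.smul_mem a hl) ?_
    rw [Algebra.smul_def]
    exact J.smul_mem _ hl
  have h2 : a * l - Q.counit a • l ∈ RingHom.ker Q.counit := by
    rw [RingHom.mem_ker]
    simp [hl1]
  exact sub_eq_zero.mp (Submodule.disjoint_def.mp hJ.disjoint _ h2 h1)

theorem IsLeftIntegral.S {l : H} (hl : Q.IsLeftIntegral l) : Q.IsRightIntegral (Q.S l) := by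
  intro a
  have h := congrArg Q.S (hl (Q.S.symm a))
  simpa [Q.S_mul] using h

theorem IsRightIntegral.S {r : H} (hr : Q.IsRightIntegral r) : Q.IsLeftIntegral (Q.S r) := by
  intro a
  have h := congrArg Q.S (hr (Q.S.symm a))
  simpa [Q.S_mul] using h

/-- Normalized left and right integrals coincide. -/
theorem IsLeftIntegral.isHaarIntegral {l r : H} (hl : Q.IsLeftIntegral l) (hl1 : Q.counit l = 1)
    (hr : Q.IsRightIntegral r) (hr1 : Q.counit r = 1) : Q.IsHaarIntegral l := by
  have h : l = r := by
    have h1 := hl r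
    have h2 := hr l
    rw [hr1, one_smul] at h1
    rw [hl1, one_smul] at h2
    exact h1.symm.trans h2
  exact ⟨hl, h ▸ hr, hl1⟩

/-! ### The separating idempotent -/

variable (Q) in
theorem mulSInvα_comul (a : H) : Q.mulSInvα (Q.comul a) = Q.counit a • Q.S.symm Q.α := by
  have e (d : H ⊗[k] H) : Q.mulSInvα d = Q.S.symm (Q.mulSα d) := by
    induction d using TensorProduct.induction_on with
    | zero => simp
    | add x y hx hy => simp only [map_add, hx, hy]
    | tmul a b => simp [mul_assoc]
  simp [e]

variable (Q) in
theorem mulβS_qR : Q.mulβS Q.qR = 1 := by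
  have e (p : H ⊗[k] (H ⊗[k] H)) :
      Q.mulβS (TensorProduct.map LinearMap.id Q.mulSInvα p) = Q.mulβSα p := by
    induction p using tensor_induction₃ with
    | zero => simp
    | add x y hx hy => simp only [map_add, hx, hy]
    | tmul a b c => simp [Q.S_mul, mul_assoc]
  rw [qR, e, mulβSα_φ]

/-- `(a ⊗ 1) q_R Δ(l) = (1 ⊗ S⁻¹(a)) q_R Δ(l)` for a left integral `l`. It follows from
`(a ⊗ 1) q_R = (1 ⊗ S⁻¹(a₍₂₎)) q_R Δ(a₍₁₎)`. -/
theorem IsLeftIntegral.tmul_one_mul_qR {l : H} (hl : Q.IsLeftIntegral l) (a : H) :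
    a ⊗ₜ 1 * (Q.qR * Q.comul l) = 1 ⊗ₜ Q.S.symm a * (Q.qR * Q.comul l) := by
  let F : H ⊗[k] (H ⊗[k] H) →ₗ[k] H ⊗[k] H := TensorProduct.map LinearMap.id Q.mulSInvα
  have F_tmul (x : H) (p : H ⊗[k] H) : F (x ⊗ₜ p) = x ⊗ₜ Q.mulSInvα p := rfl
  have e1 (x : H ⊗[k] H) (p : H ⊗[k] (H ⊗[k] H)) :
      F (Q.comulR x * p) = Q.counitR x ⊗ₜ 1 * F p := by
    induction x using TensorProduct.induction_on with
    | zero => simp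
    | add x y hx hy => simp only [map_add, add_mul, TensorProduct.add_tmul, hx, hy]
    | tmul b c =>
      induction p using tensor_induction₃ with
      | zero => simp
      | add x y hx hy => simp only [map_add, mul_add, hx, hy]
      | tmul x y z =>
        have (d : H ⊗[k] H) : Q.mulSInvα (d * y ⊗ₜ z) = Q.S.symm z * Q.mulSInvα d * y := by
          induction d using TensorProduct.induction_on with
          | zero => simp
          | add x y hx hy => simp only [map_add, mul_add, add_mul, hx, hy]
          | tmul x y => simp [mul_assoc]
        simp only [comulR_tmul, counitR_tmul, Algebra.TensorProduct.tmul_mul_tmul, F_tmul, this,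
          mulSInvα_comul]
        simp [TensorProduct.smul_tmul']
  have e2 (x : H ⊗[k] H) (p : H ⊗[k] (H ⊗[k] H)) :
      F (p * Q.comulL x) * Q.comul l = 1 ⊗ₜ Q.S.symm (Q.counitL x) * (F p * Q.comul l) := by
    induction x using TensorProduct.induction_on with
    | zero => simp
    | add x y hx hy => simp only [map_add, add_mul, mul_add, TensorProduct.tmul_add, hx, hy]
    | tmul b c =>
      have (d : H ⊗[k] H) : F (p * TensorProduct.assoc k H H H (d ⊗ₜ c)) =
          1 ⊗ₜ Q.S.symm c * (F p * d) := by
        induction d using TensorProduct.induction_on with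
        | zero => simp
        | add x y hx hy => simp only [map_add, mul_add, TensorProduct.add_tmul, hx, hy]
        | tmul d d' =>
          induction p using tensor_induction₃ with
          | zero => simp
          | add x y hx hy => simp only [map_add, mul_add, add_mul, hx, hy]
          | tmul x y z => simp [F_tmul, mul_assoc]
      rw [comulL_tmul, this, mul_assoc, mul_assoc, ← map_mul, hl b]
      simp
  have hF : Q.qR = F Q.φ := rfl
  have h := e1 (Q.comul a) Q.φ
  rw [counitR_comul, comulR_mul_φ] at h
  have h' := e2 (Q.comul a) Q.φ
  rw [h, counitL_comul, mul_assoc] at h'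
  rw [hF, h']

/-- For a normalized left integral `l` the element `q_R¹ l₍₁₎ β ⊗ S(q_R² l₍₂₎)` is a separating
idempotent. -/
theorem IsLeftIntegral.isSeparableAlgebra {l : H} (hl : Q.IsLeftIntegral l)
    (hl1 : Q.counit l = 1) : IsSeparableAlgebra k H := by
  refine ⟨TensorProduct.map (LinearMap.mulRight k Q.β) Q.S.toLinearMap (Q.qR * Q.comul l), ?_, ?_⟩
  · change Q.mulβS (Q.qR * Q.comul l) = 1
    rw [mulβS_mul_comul, hl1, one_smul, mulβS_qR]
  · intro a
    have h := congrArg (TensorProduct.map (LinearMap.mulRight k Q.β) Q.S.toLinearMap)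
      (hl.tmul_one_mul_qR a)
    have e1 (x : H ⊗[k] H) :
        TensorProduct.map (LinearMap.mulRight k Q.β) Q.S.toLinearMap (a ⊗ₜ 1 * x) =
          a ⊗ₜ 1 * TensorProduct.map (LinearMap.mulRight k Q.β) Q.S.toLinearMap x := by
      induction x using TensorProduct.induction_on with
      | zero => simp
      | add x y hx hy => simp only [map_add, mul_add, hx, hy]
      | tmul x y => simp [mul_assoc]
    have e2 (x : H ⊗[k] H) :
        TensorProduct.map (LinearMap.mulRight k Q.β) Q.S.toLinearMap (1 ⊗ₜ Q.S.symm a * x) =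
          TensorProduct.map (LinearMap.mulRight k Q.β) Q.S.toLinearMap x * 1 ⊗ₜ a := by
      induction x using TensorProduct.induction_on with
      | zero => simp
      | add x y hx hy => simp only [map_add, mul_add, add_mul, hx, hy]
      | tmul x y => simp [Q.S_mul]
    rw [← e1, h, e2]

/-! ### The cointegral `λ_e` and integrals -/

section FiniteDimensional

variable [FiniteDimensional k H]

theorem IsHaarIntegral.cointegralOfCounit_apply {e : H} (he : Q.IsHaarIntegral e) :
    Q.cointegralOfCounit e = 1 := by
  obtain ⟨-, hr, h1⟩ := he
  have h : Q.cointegralOperator e =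
      dualTensorHom k H H (Q.counit.toLinearMap ⊗ₜ e) ∘ₗ LinearMap.id := by
    ext x
    simp [hr _, counit_β_mul_counit_α]
  rw [QuasiHopfAlgebra.cointegralOfCounit_apply, h, trace_dualTensorHom_comp]
  exact h1

end FiniteDimensional

variable (Q) in
/-- The linear map `x ⊗ y ⊗ z ↦ a S(x β S(y)) ⊗ z`. -/
def liftMap (a : H) : H ⊗[k] (H ⊗[k] H) →ₗ[k] H ⊗[k] H :=
  TensorProduct.map (LinearMap.mulLeft k a ∘ₗ Q.S.toLinearMap ∘ₗ Q.mulβS) LinearMap.id ∘ₗ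
    (TensorProduct.assoc k H H H).symm.toLinearMap

variable (Q)

@[simp] theorem liftMap_tmul (a x y z : H) :
    Q.liftMap a (x ⊗ₜ (y ⊗ₜ z)) = (a * (Q.S (Q.S y) * (Q.S Q.β * Q.S x))) ⊗ₜ z := by
  simp [liftMap, Q.S_mul]

theorem liftMap_mul_comulL (a : H) (p : H ⊗[k] (H ⊗[k] H)) (x : H ⊗[k] H) :
    Q.liftMap a (p * Q.comulL x) = Q.liftMap a p * 1 ⊗ₜ Q.counitL x := by
  induction x using TensorProduct.induction_on with
  | zero => simp
  | add x y hx hy => simp only [map_add, mul_add, TensorProduct.tmul_add, hx, hy]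
  | tmul b c =>
    induction p using tensor_induction₃ with
    | zero => simp
    | add x y hx hy => simp only [map_add, add_mul, hx, hy]
    | tmul x y z =>
      have (d : H ⊗[k] H) : Q.liftMap a (x ⊗ₜ (y ⊗ₜ z) * TensorProduct.assoc k H H H (d ⊗ₜ c)) =
          (a * (Q.S (Q.S y) * (Q.S (Q.mulβS d) * Q.S x))) ⊗ₜ (z * c) := by
        induction d using TensorProduct.induction_on with
        | zero => simp
        | add x y hx hy =>
          simp only [map_add, mul_add, add_mul, TensorProduct.add_tmul, hx, hy]
        | tmul d d' => simp [Q.S_mul, mul_assoc]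
      rw [comulL_tmul, this]
      simp [TensorProduct.smul_tmul']

theorem liftMap_tmul_one_mul (a b : H) (p : H ⊗[k] (H ⊗[k] H)) :
    Q.liftMap a (b ⊗ₜ 1 * p) = Q.liftMap a p * Q.S b ⊗ₜ 1 := by
  induction p using tensor_induction₃ with
  | zero => simp
  | add x y hx hy => simp only [map_add, mul_add, add_mul, hx, hy]
  | tmul x y z => simp [Q.S_mul, mul_assoc]

theorem counitR_liftMap (a : H) (p : H ⊗[k] (H ⊗[k] H)) :
    Q.counitR (Q.liftMap a p) = a * Q.S (Q.mulβS (Q.counit₃ p)) := by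
  induction p using tensor_induction₃ with
  | zero => simp
  | add x y hx hy => simp only [map_add, mul_add, hx, hy]
  | tmul x y z => simp [Q.S_mul, mul_assoc]

/-- The right action of `H ⊗ H` on `H* ⊗ H` given by `(χ ⊗ m) · (b ⊗ c) = χ · b ⊗ m c`. -/
def tensorAct : H ⊗[k] H →ₗ[k] Module.Dual k H ⊗[k] H →ₗ[k] Module.Dual k H ⊗[k] H :=
  TensorProduct.homTensorHomMap _ _ _ _ _ ∘ₗ TensorProduct.map Q.dualRight (LinearMap.mul k H).flip

@[simp] theorem tensorAct_tmul (b c m : H) (χ : Module.Dual k H) :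
    Q.tensorAct (b ⊗ₜ c) (χ ⊗ₜ m) = (χ ∘ₗ LinearMap.mulRight k (Q.S b)) ⊗ₜ (m * c) := by
  simp [tensorAct, dualRight]

theorem dualTensorHom_tensorAct (b c : H) (τ : Module.Dual k H ⊗[k] H) :
    dualTensorHom k H H (Q.tensorAct (b ⊗ₜ c) τ) =
      LinearMap.mulRight k c ∘ₗ dualTensorHom k H H τ ∘ₗ LinearMap.mulRight k (Q.S b) := by
  induction τ using TensorProduct.induction_on with
  | zero => simp
  | add x y hx hy => simp only [map_add, hx, hy, LinearMap.add_comp, LinearMap.comp_add]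
  | tmul χ m => ext x; simp

/-- The morphism `H* ⊗ H → H` of right `H`-modules
`χ ⊗ m ↦ ⟨χ | a S(X β S(m₍₁₎ Y))⟩ m₍₂₎ Z`, which lifts `χ ⊗ m ↦ ⟨χ | a S²(m) S(β)⟩`
along `ε`. -/
def contractLift (a : H) : Module.Dual k H ⊗[k] H →ₗ[k] H :=
  (TensorProduct.lid k H).toLinearMap ∘ₗ TensorProduct.map (contractLeft k H) LinearMap.id ∘ₗ
    (TensorProduct.assoc k (Module.Dual k H) H H).symm.toLinearMap ∘ₗ
      TensorProduct.map LinearMap.id (Q.liftMap a ∘ₗ LinearMap.mulRight k Q.φ ∘ₗ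
        TensorProduct.mk k H (H ⊗[k] H) 1 ∘ₗ Q.comul.toLinearMap)

/-- `χ ⊗ id` on `H ⊗ H`. -/
def dualL (χ : Module.Dual k H) : H ⊗[k] H →ₗ[k] H :=
  (TensorProduct.lid k H).toLinearMap ∘ₗ TensorProduct.map χ LinearMap.id

@[simp] theorem dualL_tmul (χ : Module.Dual k H) (x y : H) : dualL χ (x ⊗ₜ y) = χ x • y := by
  simp [dualL]

theorem contractLift_tmul (a m : H) (χ : Module.Dual k H) :
    Q.contractLift a (χ ⊗ₜ m) = dualL χ (Q.liftMap a (1 ⊗ₜ Q.comul m * Q.φ)) := by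
  have e (p : H ⊗[k] H) : TensorProduct.lid k H (TensorProduct.map (contractLeft k H) LinearMap.id
      ((TensorProduct.assoc k (Module.Dual k H) H H).symm (χ ⊗ₜ p))) = dualL χ p := by
    induction p using TensorProduct.induction_on with
    | zero => simp
    | add x y hx hy => simp only [TensorProduct.tmul_add, map_add, hx, hy]
    | tmul x y => simp
  exact e (Q.liftMap a (1 ⊗ₜ Q.comul m * Q.φ))

theorem contractLift_tensorAct_comul (a h : H) (τ : Module.Dual k H ⊗[k] H) :
    Q.contractLift a (Q.tensorAct (Q.comul h) τ) = Q.contractLift a τ * h := by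
  induction τ using TensorProduct.induction_on with
  | zero => simp
  | add x y hx hy => simp only [map_add, hx, hy, add_mul]
  | tmul χ m =>
    have e1 (x : H ⊗[k] H) : Q.contractLift a (Q.tensorAct x (χ ⊗ₜ m)) =
        dualL χ (Q.liftMap a (1 ⊗ₜ Q.comul m * (Q.comulR x * Q.φ))) := by
      induction x using TensorProduct.induction_on with
      | zero => simp
      | add x y hx hy => simp only [map_add, LinearMap.add_apply, hx, hy, mul_add, add_mul]
      | tmul b c =>
        have hb (p : H ⊗[k] H) : dualL (χ ∘ₗ LinearMap.mulRight k (Q.S b)) p =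
            dualL χ (p * Q.S b ⊗ₜ 1) := by
          induction p using TensorProduct.induction_on with
          | zero => simp
          | add x y hx hy => simp only [map_add, add_mul, hx, hy]
          | tmul x y => simp
        rw [tensorAct_tmul, contractLift_tmul, hb, ← liftMap_tmul_one_mul, comulR_tmul,
          ← mul_assoc, ← mul_assoc]
        simp
    have e2 (p : H ⊗[k] H) : dualL χ (p * 1 ⊗ₜ h) = dualL χ p * h := by
      induction p using TensorProduct.induction_on with
      | zero => simp
      | add x y hx hy => simp only [map_add, add_mul, hx, hy]
      | tmul x y => simp
    rw [e1, comulR_mul_φ, ← mul_assoc, liftMap_mul_comulL, counitL_comul, e2, contractLift_tmul]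

section FiniteDimensional

variable [FiniteDimensional k H]

theorem counit_contractLift (a : H) (τ : Module.Dual k H ⊗[k] H) :
    Q.counit (Q.contractLift a τ) = LinearMap.trace k H (dualTensorHom k H H τ ∘ₗ
      LinearMap.mulLeft k a ∘ₗ LinearMap.mulRight k (Q.S Q.β) ∘ₗ
        Q.S.toLinearMap ∘ₗ Q.S.toLinearMap) := by
  induction τ using TensorProduct.induction_on with
  | zero => simp
  | add x y hx hy => simp only [map_add, hx, hy, LinearMap.add_comp]
  | tmul χ m =>
    have e (p : H ⊗[k] H) : Q.counit (dualL χ p) = χ (Q.counitR p) := by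
      induction p using TensorProduct.induction_on with
      | zero => simp
      | add x y hx hy => simp only [map_add, hx, hy]
      | tmul x y => simp [mul_comm]
    rw [contractLift_tmul, e, counitR_liftMap, map_mul Q.counit₃, counit₃_φ, mul_one,
      trace_dualTensorHom_comp]
    simp [Q.S_mul]

/-- The element of `H* ⊗ H` given by `m ↦ m α` is invariant, so `contractLift a` maps it to a right
integral. -/
theorem exists_isRightIntegral_counit_eq (a : H) :
    ∃ r : H, Q.IsRightIntegral r ∧ Q.counit r = Q.cointegralOfCounit a := by
  let τ : Module.Dual k H ⊗[k] H := (dualTensorHomEquiv k H H).symm (LinearMap.mulRight k Q.α)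
  have hτ : dualTensorHom k H H τ = LinearMap.mulRight k Q.α :=
    (dualTensorHomEquiv k H H).apply_symm_apply _
  have inv (h : H) : Q.tensorAct (Q.comul h) τ = Q.counit h • τ := by
    apply (dualTensorHomEquiv k H H).injective
    change dualTensorHom k H H _ = dualTensorHom k H H _
    have e (x : H ⊗[k] H) : dualTensorHom k H H (Q.tensorAct x τ) =
        LinearMap.mulRight k (Q.mulSα x) := by
      induction x using TensorProduct.induction_on with
      | zero => ext; simp
      | add x y hx hy =>
        simp only [map_add, LinearMap.add_apply, hx, hy]
        ext; simp [mul_add]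
      | tmul b c =>
        rw [dualTensorHom_tensorAct, hτ]
        ext; simp [mul_assoc]
    rw [e, mulSα_comul, map_smul, hτ]
    ext; simp
  refine ⟨Q.contractLift a τ, fun h => ?_, ?_⟩
  · rw [← contractLift_tensorAct_comul, inv, map_smul]
  · rw [counit_contractLift, hτ, cointegralOfCounit_apply]
    congr 1
    ext x
    simp [mul_assoc]

end FiniteDimensional

end QuasiHopfAlgebra

end

theorem theorem5 {k H : Type*} [Field k] [Ring H] [Algebra k H] [FiniteDimensional k H]
    (Q : QuasiHopfAlgebra k H) :
    Q.cointegralOfCounit ∈ Q.leftCointegrals ∧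
    (∀ {ι : Type*} [Fintype ι] (b : Module.Basis ι k H) (a : H),
      Q.cointegralOfCounit a = ∑ i, b.coord i (a * (Q.S (Q.S (b i)) * Q.S Q.β * Q.α))) ∧
    List.TFAE [
      IsSemisimpleRing H,
      ∃ l : H, Q.IsLeftIntegral l ∧ Q.counit l = 1,
      ∃ r : H, Q.IsRightIntegral r ∧ Q.counit r = 1,
      Q.cointegralOfCounit ≠ 0,
      ∃ e : H, Q.IsHaarIntegral e,
      IsSeparableAlgebra k H] ∧
    ∀ e : H, Q.IsHaarIntegral e → Q.cointegralOfCounit e = 1 := by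
  refine ⟨⟨_, rfl⟩, fun b a => Q.cointegralOfCounit_apply_basis b a, ?_,
    fun e he => he.cointegralOfCounit_apply⟩
  tfae_have 1 → 2 := fun _ => Q.exists_isLeftIntegral_of_isSemisimpleRing
  tfae_have 3 → 5 := by
    rintro ⟨r, hr, hr1⟩
    exact ⟨_, hr.S.isHaarIntegral (by simpa using hr1) hr hr1⟩
  tfae_have 2 → 3 := by
    rintro ⟨l, hl, hl1⟩
    exact ⟨Q.S l, hl.S, by simpa using hl1⟩
  tfae_have 5 → 6 := by
    rintro ⟨e, he, -, he1⟩
    exact he.isSeparableAlgebra he1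
  tfae_have 6 → 1 := fun h => h.isSemisimpleRing
  tfae_have 5 → 4 := by
    rintro ⟨e, he⟩ h0
    have h := he.cointegralOfCounit_apply
    rw [h0, LinearMap.zero_apply] at h
    exact zero_ne_one h
  tfae_have 4 → 3 := by
    intro h0
    -- Rescale a right integral whose counit is a nonzero value of `λ_e`.
    obtain ⟨a, ha⟩ : ∃ a, Q.cointegralOfCounit a ≠ 0 := by
      by_contra! hc
      exact h0 (LinearMap.ext hc)
    obtain ⟨r, hr, hra⟩ := Q.exists_isRightIntegral_counit_eq a
    rw [← hra] at ha
    refine ⟨(Q.counit r)⁻¹ • r, fun h => ?_, ?_⟩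
    · rw [smul_mul_assoc, hr h, smul_comm]
    · rw [map_smul, smul_eq_mul, inv_mul_cancel₀ ha]
  tfae_finish
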